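/- Let $L$ be a first-order language, $M$ an $L$-structure, and $G(M)$ a group $\emptyset$-definable in $M$ which is also equipped with a group topology (the topology need not be definable). Let $M^*\succ M$ be a monster model, i.e. $M^*$ is $\kappa$-saturated and strongly $\kappa$-homogeneous for a cardinal $\kappa>2^{|M|+|L|+\aleph_0}$, and let $G=G(M^*)$. Bounded index means index less than $\kappa$. Let $\mu\subseteq G$ be the intersection of the sets $U(M^*)$, where $U$ ranges over the $M$-definable neighbourhoods of the identity of $G(M)$. Let $G^{00}_M$ be the smallest $M$-type-definable subgroup of $G$ of bounded index, let $G^{000}_M$ be the smallest subgroup of $G$ of bounded index which is invariant under $\mathrm{Aut}(M^*/M)$, and put $$G^{00}_{\mathrm{def,top}}=\mu\cdot G^{00}_M,\qquad G^{000}_{\mathrm{def,top}}=\langle\mu^{G}\rangle\cdot G^{000}_M,$$ where $\langle\mu^G\rangle$ is the normal subgroup of $G$ generated by $\mu$. When all open subsets of $G(M)$ are $\emptyset$-definable in $M$, these two sets are denoted by $G^{00}_{\mathrm{top}}$ and $G^{000}_{\mathrm{top}}$. Let $S_G(M)$ be the space of complete types over $M$ of elements of $G$, with $G(M)$ acting by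 $g\cdot\mathrm{tp}(a/M)=\mathrm{tp}(ga/M)$, and let $S^\mu_G(M)$ be its topological quotient by the relation $p\sim_\mu q\iff\mu\cdot p=\mu\cdot q$, where $\mu\cdot p=\{ab: a\in\mu,\ b\models p\}$, with the induced action of $G(M)$. (1) Assume that the identity of $G(M)$ has a basis of (not necessarily open) neighbourhoods that are definable in $M$ with parameters from $M$. If $G(M)$ is definably topologically amenable, i.e. $S^\mu_G(M)$ carries a $G(M)$-invariant Borel probability measure, then $G^{00}_{\mathrm{def,top}}=G^{000}_{\mathrm{def,top}}$. (2) Assume that all open subsets of $G(M)$ are $\emptyset$-definable in $M$ (every topological group can be presented in this way). If $G(M)$ is amenable as a topological group, i.e. every $G(M)$-flow (a nonempty compact Hausdorff space with a continuous action of $G(M)$) carries a $G(M)$-invariant Borel probability measure, then $G^{00}_{\mathrm{top}}=G^{000}_{\mathrm{top}}$. In other words, $G(M)\to G/G^{00}_{\mathrm{top}}$ and $G(M)\to G/G^{000}_{\mathrm{top}}$, which are called the Bohr compactification and the weak Bohr compactification of $G(M)$, coincide. -/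

import Mathlib

open FirstOrder FirstOrder.Language Cardinal Topology
open scoped Pointwise

universe u v w w'

/-! ### Monster models -/

/-- `N` is `κ`-saturated: every set of formulas in one variable over fewer than `κ` parameters
which is finitely satisfiable in `N` is realized in `N`. -/
def IsKappaSaturated (L : FirstOrder.Language.{u, v}) (N : Type w') [L.Structure N]
    (κ : Cardinal.{w'}) : Prop :=
  ∀ A : Set N, #A < κ → ∀ Γ : Set (L.Formula (A ⊕ Unit)),
    (∀ Δ : Finset (L.Formula (A ⊕ Unit)), (Δ : Set (L.Formula (A ⊕ Unit))) ⊆ Γ →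
      ∃ x : N, ∀ θ ∈ Δ, θ.Realize (Sum.elim (fun a : A => (a : N)) (fun _ => x))) →
    ∃ x : N, ∀ θ ∈ Γ, θ.Realize (Sum.elim (fun a : A => (a : N)) (fun _ => x))

/-- `N` is strongly `κ`-homogeneous: every partial elementary map of `N` whose domain has fewer
than `κ` elements extends to an automorphism of `N`. -/
def IsStronglyHomogeneous (L : FirstOrder.Language.{u, v}) (N : Type w') [L.Structure N]
    (κ : Cardinal.{w'}) : Prop :=
  ∀ A : Set N, #A < κ → ∀ f : A → N,
    (∀ θ : L.Formula A, θ.Realize (fun a : A => (a : N)) ↔ θ.Realize f) →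
    ∃ σ : N ≃[L] N, ∀ a : A, σ a = f a

/-- `N` is a monster model with respect to the (small) model `M`, with saturation cardinal `κ`:
it is `κ`-saturated and strongly `κ`-homogeneous, where `κ > 2 ^ (|M| + |L| + ℵ₀)`. Sets of
cardinality less than `κ` are the small ones. -/
structure IsMonster (L : FirstOrder.Language.{u, v}) (M : Type w) (N : Type w') [L.Structure N]
    (κ : Cardinal.{w'}) : Prop where
  large : Cardinal.lift.{w'} ((2 : Cardinal.{max u v w}) ^
      (Cardinal.lift.{max u v} #M + Cardinal.lift.{w} L.card + ℵ₀)) <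
    Cardinal.lift.{max u v w} κ
  saturated : IsKappaSaturated L N κ
  homogeneous : IsStronglyHomogeneous L N κ

/-! ### Definable groups -/

/-- A pair of formulas without parameters, meant to define a group: `carrier` defines the
underlying set (of `dim`-tuples) and `mul` the graph of the multiplication. -/
structure GroupFormulas (L : FirstOrder.Language.{u, v}) where
  /-- The length of the tuples. -/
  dim : ℕ
  /-- The formula `G(x)`. -/
  carrier : L.Formula (Fin dim)
  /-- The formula `x * y = z`. -/
  mul : L.Formula (Fin dim ⊕ (Fin dim ⊕ Fin dim))

/-- The interpretation `G(N)` of the formula `G(x)` in the structure `N`: the set of all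
`dim`-tuples of elements of `N` that satisfy `G(x)`. -/
@[ext]
structure GroupFormulas.Points {L : FirstOrder.Language.{u, v}} (F : GroupFormulas L)
    (N : Type w) [L.Structure N] : Type w where
  /-- The tuple. -/
  coords : Fin F.dim → N
  realize : F.carrier.Realize coords

/-- The formulas `F` define a group in `N`: this is the group structure on the set `G(N)` whose
multiplication has the graph defined by `F.mul`. It is unique, and it exists in `N` as soon as it
exists in an elementarily equivalent structure. -/
class GroupFormulas.GroupIn {L : FirstOrder.Language.{u, v}} (F : GroupFormulas L) (N : Type w)
    [L.Structure N] extends Group (F.Points N) where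
  mul_iff : ∀ a b c : F.Points N,
    F.mul.Realize (Sum.elim a.1 (Sum.elim b.1 c.1)) ↔ a * b = c

namespace GroupFormulas

section

variable {L : FirstOrder.Language.{u, v}} (F : GroupFormulas L) {M : Type w} [L.Structure M]
  {N : Type w'} [L.Structure N] (j : M ↪ₑ[L] N)

/-- Formulas `θ(x)` with parameters from `M`, in a `dim`-tuple of variables `x`. -/
abbrev MFormula (M : Type w) : Type (max u v w) := L.Formula (M ⊕ Fin F.dim)

/-- The `M`-definable subset `G(N) ∩ θ(N)` of `G(N)`, for `M ≺ N`. -/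
def defSet (θ : F.MFormula M) : Set (F.Points N) :=
  {a | θ.Realize (Sum.elim j a.1)}

/-- The `M`-definable subset `G(M) ∩ θ(M)` of `G(M)`. -/
def defSetBase (θ : F.MFormula M) : Set (F.Points M) :=
  F.defSet (ElementaryEmbedding.refl L M) θ

variable [F.GroupIn M] [F.GroupIn N]

/-- The inclusion of `G(M)` in `G(N)`, for `M ≺ N`. -/
def incl : F.Points M →* F.Points N :=
  MonoidHom.mk' (fun g => ⟨j ∘ g.1, (j.map_formula F.carrier g.1).2 g.2⟩) (by
    intro a b
    refine ((GroupIn.mul_iff (F := F) _ _ _).1 ?_).symm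
    have h := (GroupIn.mul_iff (F := F) a b (a * b)).2 rfl
    have h' := (j.map_formula F.mul _).2 h
    simpa only [Sum.comp_elim] using h')

/-! ### Infinitesimals and connected components -/

/-- The infinitesimals `μ ⊆ G(N)`: the intersection of all `U(N)`, where `U` ranges over the
`M`-definable neighbourhoods of the identity of `G(M)`. -/
def infinitesimals [TopologicalSpace (F.Points M)] : Set (F.Points N) :=
  {a | ∀ θ : F.MFormula M, F.defSetBase θ ∈ 𝓝 (1 : F.Points M) → a ∈ F.defSet j θ}

/-- `X ⊆ G(N)` is `M`-type-definable. -/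
def IsTypeDefinable (X : Set (F.Points N)) : Prop :=
  ∃ Γ : Set (F.MFormula M), X = ⋂ θ ∈ Γ, F.defSet j θ

/-- `X ⊆ G(N)` is invariant over `M`, that is, under all automorphisms of `N` that fix `M`
pointwise. -/
def IsInvariantOver (X : Set (F.Points N)) : Prop :=
  ∀ σ : N ≃[L] N, (∀ m : M, σ (j m) = j m) →
    ∀ a b : F.Points N, b.1 = σ ∘ a.1 → a ∈ X → b ∈ X

/-- The component `G^{00}_M`: the smallest `M`-type-definable subgroup of `G(N)` of bounded
index (index less than `κ`). -/
def component00 (κ : Cardinal.{w'}) : Subgroup (F.Points N) :=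
  sInf {H | F.IsTypeDefinable j (H : Set (F.Points N)) ∧ #(F.Points N ⧸ H) < κ}

/-- The component `G^{000}_M`: the smallest subgroup of `G(N)` of bounded index which is
invariant over `M`. -/
def component000 (κ : Cardinal.{w'}) : Subgroup (F.Points N) :=
  sInf {H | F.IsInvariantOver j (H : Set (F.Points N)) ∧ #(F.Points N ⧸ H) < κ}

/-- `G^{00}_{def,top} = μ · G^{00}_M`. When all open subsets of `G(M)` are definable without
parameters, this is `G^{00}_{top}`. -/
def component00DefTop [TopologicalSpace (F.Points M)] (κ : Cardinal.{w'}) :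
    Set (F.Points N) :=
  F.infinitesimals j * (F.component00 j κ : Set (F.Points N))

/-- `G^{000}_{def,top} = ⟨μ^G⟩ · G^{000}_M`. When all open subsets of `G(M)` are definable without
parameters, this is `G^{000}_{top}`. -/
def component000DefTop [TopologicalSpace (F.Points M)] (κ : Cardinal.{w'}) :
    Set (F.Points N) :=
  (Subgroup.normalClosure (F.infinitesimals j) : Set (F.Points N)) *
    (F.component000 j κ : Set (F.Points N))

/-! ### Definability hypotheses on the topology of `G(M)` -/

/-- Some basis of (not necessarily open) neighbourhoods of the identity of `G(M)` consists of sets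
definable with parameters from `M`. -/
def HasDefinableNhdsBasis (M : Type w) [L.Structure M] [F.GroupIn M]
    [TopologicalSpace (F.Points M)] : Prop :=
  ∀ U ∈ 𝓝 (1 : F.Points M), ∃ θ : F.MFormula M,
    F.defSetBase θ ∈ 𝓝 (1 : F.Points M) ∧ F.defSetBase θ ⊆ U

/-- All open subsets of `G(M)` are definable without parameters. -/
def AllOpensDefinable (M : Type w) [L.Structure M] [TopologicalSpace (F.Points M)] : Prop :=
  ∀ U : Set (F.Points M), IsOpen U →
    ∃ θ : L.Formula (Fin F.dim), U = {a | θ.Realize a.1}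

/-! ### Translates of definable sets -/

/-- A formula defining `{x | g * x * h ∈ θ}`. -/
noncomputable def translate (g h : F.Points M) (θ : F.MFormula M) : F.MFormula M :=
  Formula.iExs (Fin F.dim ⊕ Fin F.dim)
    (F.carrier.relabel (fun i => (Sum.inr (Sum.inl i) : (M ⊕ Fin F.dim) ⊕ _)) ⊓
      (F.carrier.relabel (fun i => Sum.inr (Sum.inr i)) ⊓
        (F.mul.relabel (Sum.elim (fun i => Sum.inl (Sum.inl (g.1 i)))
            (Sum.elim (fun i => Sum.inl (Sum.inr i)) (fun i => Sum.inr (Sum.inl i)))) ⊓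
          (F.mul.relabel (Sum.elim (fun i => Sum.inr (Sum.inl i))
              (Sum.elim (fun i => Sum.inl (Sum.inl (h.1 i))) (fun i => Sum.inr (Sum.inr i)))) ⊓
            θ.relabel (Sum.elim (fun m => Sum.inl (Sum.inl m))
              (fun i => Sum.inr (Sum.inr i)))))))

theorem mem_defSet_translate (g h : F.Points M) (θ : F.MFormula M) (a : F.Points N) :
    a ∈ F.defSet j (F.translate g h θ) ↔ F.incl j g * a * F.incl j h ∈ F.defSet j θ := by
  have key : ∀ y z : Fin F.dim → N,
      ((F.carrier.relabel (fun i => (Sum.inr (Sum.inl i) : (M ⊕ Fin F.dim) ⊕ _)) ⊓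
        (F.carrier.relabel (fun i => Sum.inr (Sum.inr i)) ⊓
        (F.mul.relabel (Sum.elim (fun i => Sum.inl (Sum.inl (g.1 i)))
            (Sum.elim (fun i => Sum.inl (Sum.inr i)) (fun i => Sum.inr (Sum.inl i)))) ⊓
          (F.mul.relabel (Sum.elim (fun i => Sum.inr (Sum.inl i))
              (Sum.elim (fun i => Sum.inl (Sum.inl (h.1 i))) (fun i => Sum.inr (Sum.inr i)))) ⊓
            θ.relabel (Sum.elim (fun m => Sum.inl (Sum.inl m))
              (fun i => Sum.inr (Sum.inr i))))))) : L.Formula _).Realize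
          (Sum.elim (Sum.elim j a.1) (Sum.elim y z)) ↔
        F.carrier.Realize y ∧ F.carrier.Realize z ∧
          F.mul.Realize (Sum.elim (F.incl j g).1 (Sum.elim a.1 y)) ∧
          F.mul.Realize (Sum.elim y (Sum.elim (F.incl j h).1 z)) ∧
          θ.Realize (Sum.elim j z) := by
    intro y z
    simp only [Formula.realize_inf, Formula.realize_relabel, Sum.comp_elim]
    rfl
  constructor
  · intro ha
    obtain ⟨w, hw⟩ := Formula.realize_iExs.1 ha
    have hw' : w = Sum.elim (w ∘ Sum.inl) (w ∘ Sum.inr) := by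
      ext i; cases i <;> rfl
    rw [hw'] at hw
    obtain ⟨hy, hz, h1, h2, h3⟩ := (key _ _).1 hw
    have e1 := (GroupIn.mul_iff (F := F) (F.incl j g) a ⟨_, hy⟩).1 h1
    have e2 := (GroupIn.mul_iff (F := F) ⟨_, hy⟩ (F.incl j h) ⟨_, hz⟩).1 h2
    rw [e1, e2]
    exact h3
  · intro ha
    refine Formula.realize_iExs.2 ⟨Sum.elim (F.incl j g * a).1 (F.incl j g * a * F.incl j h).1, ?_⟩
    exact (key _ _).2 ⟨(F.incl j g * a).2, (F.incl j g * a * F.incl j h).2,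
      (GroupIn.mul_iff (F := F) _ _ _).2 rfl, (GroupIn.mul_iff (F := F) _ _ _).2 rfl, ha⟩

theorem mem_defSetBase_translate (g h : F.Points M) (θ : F.MFormula M) (a : F.Points M) :
    a ∈ F.defSetBase (F.translate g h θ) ↔ g * a * h ∈ F.defSetBase θ :=
  F.mem_defSet_translate (ElementaryEmbedding.refl L M) g h θ a

theorem conj_mem_infinitesimals [TopologicalSpace (F.Points M)] [IsTopologicalGroup (F.Points M)]
    (g : F.Points M) {a : F.Points N} (ha : a ∈ F.infinitesimals j) :
    F.incl j g * a * F.incl j g⁻¹ ∈ F.infinitesimals j := by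
  intro θ hθ
  rw [← F.mem_defSet_translate]
  refine ha _ ?_
  have hc : Continuous fun x : F.Points M => g * x * g⁻¹ := by fun_prop
  have h1 : (fun x : F.Points M => g * x * g⁻¹) ⁻¹' F.defSetBase θ ∈ 𝓝 (1 : F.Points M) :=
    hc.continuousAt.preimage_mem_nhds (by simpa using hθ)
  filter_upwards [h1] with x hx
  exact (F.mem_defSetBase_translate g g⁻¹ θ x).2 hx

/-! ### The space of types and the ambit `S_G^μ(M)` -/

/-- Two elements of `G(N)` have the same complete type over `M`. -/
def sameType : Setoid (F.Points N) where
  r a b := ∀ θ : F.MFormula M, a ∈ F.defSet j θ ↔ b ∈ F.defSet j θ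
  iseqv := ⟨fun _ _ => Iff.rfl, fun h θ => (h θ).symm, fun h h' θ => (h θ).trans (h' θ)⟩

/-- The space `S_G(M)` of complete types over `M` containing the formula `G(x)`. As `N` is
saturated over `M`, all of these types are realized in `G(N)`, and so the space of types is the
quotient of `G(N)` by equality of types. -/
def TypeSpace : Type w' := Quotient (F.sameType j)

/-- The type over `M` of an element of `G(N)`. -/
def tp (a : F.Points N) : F.TypeSpace j := Quotient.mk (F.sameType j) a

/-- The topology of the space of types, with the basis of the sets of types that contain a given
formula. -/
instance : TopologicalSpace (F.TypeSpace j) :=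
  TopologicalSpace.generateFrom {U | ∃ θ : F.MFormula M, U = F.tp j '' F.defSet j θ}

/-- The action of `G(M)` on `S_G(M)`: `g • tp(a/M) = tp(ga/M)`. -/
def typeSMul (g : F.Points M) : F.TypeSpace j → F.TypeSpace j :=
  Quotient.map' (s₁ := F.sameType j) (s₂ := F.sameType j) (fun a => F.incl j g * a) (by
    intro a b hab θ
    have h := hab (F.translate g 1 θ)
    simpa only [F.mem_defSet_translate, map_one, mul_one] using h)

/-- The set `μ · p` of all products `a * b` with `a ∈ μ` and `b` a realization of `p`. -/
def infMul [TopologicalSpace (F.Points M)] (p : F.TypeSpace j) : Set (F.Points N) :=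
  F.infinitesimals j * {b | F.tp j b = p}

/-- The relation `p ∼ q ↔ μ · p = μ · q` on `S_G(M)`. -/
def infSetoid [TopologicalSpace (F.Points M)] : Setoid (F.TypeSpace j) :=
  Setoid.ker (F.infMul j)

/-- The space `S_G^μ(M)`, the quotient of `S_G(M)` by `p ∼ q ↔ μ · p = μ · q`. -/
def Ambit [TopologicalSpace (F.Points M)] : Type w' := Quotient (F.infSetoid j)

/-- The quotient topology. -/
instance [TopologicalSpace (F.Points M)] : TopologicalSpace (F.Ambit j) :=
  inferInstanceAs (TopologicalSpace (Quotient (F.infSetoid j)))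

/-- The Borel `σ`-algebra. -/
instance [TopologicalSpace (F.Points M)] : MeasurableSpace (F.Ambit j) := borel _

theorem infMul_typeSMul [TopologicalSpace (F.Points M)] [IsTopologicalGroup (F.Points M)]
    (g : F.Points M) (p : F.TypeSpace j) :
    F.infMul j (F.typeSMul j g p) = (fun x => F.incl j g * x) '' F.infMul j p := by
  have hinv : ∀ q : F.TypeSpace j, F.typeSMul j g⁻¹ (F.typeSMul j g q) = q := by
    intro q
    induction q using Quotient.inductionOn with
    | h a => exact congrArg (F.tp j) (by simp)
  ext x
  constructor
  · rintro ⟨a, ha, b, hb, rfl⟩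
    refine ⟨F.incl j g⁻¹ * a * F.incl j (g⁻¹)⁻¹ * (F.incl j g⁻¹ * b),
      ⟨_, F.conj_mem_infinitesimals j g⁻¹ ha, F.incl j g⁻¹ * b, ?_, rfl⟩, ?_⟩
    · have hb' : F.tp j b = F.typeSMul j g p := hb
      have h := hinv p
      rw [← hb'] at h
      exact h
    · simp [mul_assoc]
  · rintro ⟨_, ⟨a, ha, b, hb, rfl⟩, rfl⟩
    refine ⟨_, F.conj_mem_infinitesimals j g ha, F.incl j g * b, ?_, ?_⟩
    · have hb' : F.tp j b = p := hb
      rw [← hb']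
      rfl
    · simp [mul_assoc]

/-- The action of `G(M)` on `S_G^μ(M)` induced by its action on `S_G(M)`. -/
def ambitSMul [TopologicalSpace (F.Points M)] [IsTopologicalGroup (F.Points M)]
    (g : F.Points M) : F.Ambit j → F.Ambit j :=
  Quotient.map' (s₁ := F.infSetoid j) (s₂ := F.infSetoid j) (F.typeSMul j g) (by
    intro p q hpq
    have h : F.infMul j p = F.infMul j q := hpq
    change F.infMul j _ = F.infMul j _
    rw [F.infMul_typeSMul, F.infMul_typeSMul, h])

/-- `G(M)` is definably topologically amenable: `S_G^μ(M)` carries a left-invariant Borel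
probability measure. -/
def DefinablyTopologicallyAmenable [TopologicalSpace (F.Points M)]
    [IsTopologicalGroup (F.Points M)] : Prop :=
  ∃ ν : MeasureTheory.Measure (F.Ambit j), MeasureTheory.IsProbabilityMeasure ν ∧
    ∀ g : F.Points M, ∀ B : Set (F.Ambit j), MeasurableSet B →
      ν (F.ambitSMul j g ⁻¹' B) = ν B

end

end GroupFormulas

/-- The topological group `G` is amenable: every `G`-flow, that is, every nonempty compact
Hausdorff space with a continuous action of `G`, carries a `G`-invariant Borel probability
measure. -/
def IsAmenableTopGroup (G : Type w) [Group G] [TopologicalSpace G] : Prop :=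
  ∀ (X : Type w) [TopologicalSpace X] [CompactSpace X] [T2Space X] [Nonempty X]
    [MeasurableSpace X] [BorelSpace X] [MulAction G X] [ContinuousSMul G X],
    ∃ ν : MeasureTheory.Measure X, MeasureTheory.IsProbabilityMeasure ν ∧
      ∀ g : G, ∀ B : Set X, MeasurableSet B → ν ((fun x => g • x) ⁻¹' B) = ν B

/-! Let J (`typeSubgroup`) be the subgroup of G generated by all quotients a⁻¹b of elements with the
same type over M. It is normal, and it lies in every M-invariant subgroup H of bounded index: if a
coheir extension of tp(a/M) produced a quotient outside H, iterating it would give κ distinct cosets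
(`inv_mul_mem_of_sameType`). So J ≤ G^{000}_M. Elements with the same type agree modulo J, every
type over M is finitely satisfiable in G(M), and G(M) normalizes μ. Hence ⟨μ^G⟩ ⊆ μ·J, and this
gives G^{000}_{def,top} ⊆ G^{00}_{def,top} without any amenability (`component000DefTop_subset`).

Amenability is needed for G^{00}_M ≤ ⟨μ^G⟩·J (`component00_le`), from which the other inclusion
follows. Both notions of amenability are first reduced to one structure, `MeasureModel`: an
assignment X ↦ C X of closed sets in a probability space to definable sets, equivariant under G(M),
additive for unions, and such that C X and C Y are disjoint when a neighbourhood of 1 separates X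
from Y. In (1) the space is S^μ_G(M) and C X is the image of X; in (2) it is the Samuel
compactification of G(M) and C X is the closure of X ∩ G(M).

The core is a Massicot–Wagner stabilizer argument, `exists_isGenericNhd_pow_subset`. Measure is not
definable, so positivity of measure is replaced by the definable notion `Large`, which expresses an
iterated covering property. A large set B is chosen so that the measure of C(BX) almost cannot be
lowered by passing to the next kind of large subset. The g for which gB ∩ B is robustly large then
move C(BX) by at most ε, so products of m of them still make it meet itself. This gives a definable
generic symmetric S with S^m ⊆ W(DX)(DX)⁻¹.

Iterating with m = 14 produces a type-definable subgroup of bounded index inside S^7, so G^{00}_M ⊆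
S^7 for every generic S. By saturation some type p contains only definable sets of positive measure.
Taking D and X ever closer to p and W ever closer to μ traps G^{00}_M in μ·(μpp)·(μpp)⁻¹. Modulo
⟨μ^G⟩·J the type p is a single point and μ is trivial, so this product is trivial. -/

namespace GroupFormulas

/-! ### Definable relations and functions on G(N). -/

section Definability

variable {L : FirstOrder.Language.{u, v}} (F : GroupFormulas L) {M : Type w} [L.Structure M]
  {N : Type w'} [L.Structure N] (j : M ↪ₑ[L] N)

/-- The assignment of elements of `N` to the parameters from `M` and to the coordinates of a
family of elements of `G(N)`. -/
def valuation {α : Type*} (x : α → F.Points N) : M ⊕ (α × Fin F.dim) → N :=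
  Sum.elim j fun q => (x q.1).coords q.2

/-- `P` is a relation on `G(N)`, in the variables indexed by `α`, that is definable with
parameters from `M`. -/
def DefRel {α : Type*} (P : (α → F.Points N) → Prop) : Prop :=
  ∃ φ : L.Formula (M ⊕ (α × Fin F.dim)), ∀ x, P x ↔ φ.Realize (F.valuation j x)

/-- `X` is an `M`-definable subset of `G(N)`. -/
def IsDef (X : Set (F.Points N)) : Prop := ∃ θ : F.MFormula M, X = F.defSet j θ

/-- Quantification over finitely many elements of the group. -/
noncomputable def exPoints {γ : Type*} (β : Type*) [Finite β]
    (φ : L.Formula (γ ⊕ (β × Fin F.dim))) : L.Formula γ :=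
  Formula.iExs (β × Fin F.dim) (φ ⊓
    Formula.iInf fun b : β => F.carrier.relabel fun i => (Sum.inr (b, i) : γ ⊕ (β × Fin F.dim)))

theorem realize_exPoints {K : Type*} [L.Structure K] {γ β : Type*} [Finite β]
    (φ : L.Formula (γ ⊕ (β × Fin F.dim))) (x : γ → K) :
    (F.exPoints β φ).Realize x ↔
      ∃ y : β → F.Points K, φ.Realize (Sum.elim x fun q => (y q.1).coords q.2) := by
  rw [exPoints, Formula.realize_iExs]
  constructor
  · rintro ⟨z, hz⟩
    rw [Formula.realize_inf, Formula.realize_iInf] at hz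
    refine ⟨fun b => ⟨fun i => z (b, i), ?_⟩, hz.1⟩
    exact (Formula.realize_relabel.1 (hz.2 b) :)
  · rintro ⟨y, hy⟩
    refine ⟨fun q => (y q.1).coords q.2, ?_⟩
    rw [Formula.realize_inf, Formula.realize_iInf]
    exact ⟨hy, fun b => Formula.realize_relabel.2 (y b).realize⟩

variable {F j}

section Closure

variable {α β : Type*} {P Q : (α → F.Points N) → Prop}

theorem DefRel.congr (h : F.DefRel j P) (hPQ : ∀ x, Q x ↔ P x) : F.DefRel j Q :=
  h.imp fun _ hφ x => (hPQ x).trans (hφ x)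

theorem DefRel.not (h : F.DefRel j P) : F.DefRel j fun x => ¬ P x := by
  obtain ⟨φ, hφ⟩ := h
  exact ⟨φ.not, fun x => (not_congr (hφ x)).trans Formula.realize_not.symm⟩

theorem DefRel.and (h : F.DefRel j P) (h' : F.DefRel j Q) : F.DefRel j fun x => P x ∧ Q x := by
  obtain ⟨φ, hφ⟩ := h
  obtain ⟨ψ, hψ⟩ := h'
  exact ⟨φ ⊓ ψ, fun x => (and_congr (hφ x) (hψ x)).trans Formula.realize_inf.symm⟩

theorem DefRel.or (h : F.DefRel j P) (h' : F.DefRel j Q) : F.DefRel j fun x => P x ∨ Q x :=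
  (h.not.and h'.not).not.congr fun x => by tauto

theorem DefRel.imp (h : F.DefRel j P) (h' : F.DefRel j Q) : F.DefRel j fun x => P x → Q x :=
  (h.and h'.not).not.congr fun x => by tauto

theorem DefRel.all_finite [Finite β] {P : β → (α → F.Points N) → Prop}
    (h : ∀ b, F.DefRel j (P b)) : F.DefRel j fun x => ∀ b, P b x := by
  choose φ hφ using h
  exact ⟨Formula.iInf φ, fun x => by simp only [hφ, Formula.realize_iInf]⟩

theorem DefRel.ex_finite [Finite β] {P : β → (α → F.Points N) → Prop}
    (h : ∀ b, F.DefRel j (P b)) : F.DefRel j fun x => ∃ b, P b x :=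
  (DefRel.all_finite fun b => (h b).not).not.congr fun x => by simp

theorem DefRel.reindex (h : F.DefRel j P) (f : α → β) :
    F.DefRel j fun x : β → F.Points N => P fun a => x (f a) := by
  obtain ⟨φ, hφ⟩ := h
  refine ⟨φ.relabel (Sum.map id fun q => (f q.1, q.2)), fun x => (hφ _).trans ?_⟩
  rw [Formula.realize_relabel]
  exact iff_of_eq (congrArg _ (by ext (m | q) <;> rfl))

theorem DefRel.exTuple [Finite β] {P : (α → F.Points N) → (β → F.Points N) → Prop}
    (h : F.DefRel j fun z : α ⊕ β → F.Points N => P (fun a => z (.inl a)) fun b => z (.inr b)) :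
    F.DefRel j fun x => ∃ y, P x y := by
  obtain ⟨φ, hφ⟩ := h
  refine ⟨F.exPoints β (φ.relabel (Sum.elim (fun m => Sum.inl (Sum.inl m)) fun q =>
    q.1.elim (fun a => Sum.inl (Sum.inr (a, q.2))) fun b => Sum.inr (b, q.2))), fun x => ?_⟩
  rw [realize_exPoints]
  refine exists_congr fun y => ?_
  rw [Formula.realize_relabel, ← show _ ↔ P x y from Iff.rfl]
  refine (hφ (Sum.elim x y)).trans (iff_of_eq (congrArg _ ?_))
  ext (m | ⟨a | b, i⟩) <;> rfl

theorem DefRel.ex {P : F.Points N → (α → F.Points N) → Prop}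
    (h : F.DefRel j fun z : Option α → F.Points N => P (z none) fun a => z (some a)) :
    F.DefRel j fun x => ∃ y, P y x := by
  have h1 : F.DefRel j fun x : α → F.Points N => ∃ y : Unit → F.Points N, P (y ()) x :=
    DefRel.exTuple (P := fun x y => P (y ()) x)
      (h.reindex fun o : Option α => o.elim (Sum.inr ()) Sum.inl)
  exact h1.congr fun x => ⟨fun ⟨y, hy⟩ => ⟨fun _ => y, hy⟩, fun ⟨y, hy⟩ => ⟨y (), hy⟩⟩

theorem DefRel.all {P : F.Points N → (α → F.Points N) → Prop}
    (h : F.DefRel j fun z : Option α → F.Points N => P (z none) fun a => z (some a)) :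
    F.DefRel j fun x => ∀ y, P y x :=
  (DefRel.ex (P := fun y x => ¬ P y x) h.not).not.congr fun x => by simp

theorem defRel_eq (a b : α) : F.DefRel j fun x => x a = x b := by
  refine ⟨Formula.iInf fun i : Fin F.dim =>
    Term.equal (Term.var (Sum.inr (a, i))) (Term.var (Sum.inr (b, i))), fun x => ?_⟩
  simp only [Formula.realize_iInf, Formula.realize_equal, Term.realize_var, valuation,
    Sum.elim_inr]
  exact ⟨fun h i => by rw [h], fun h => Points.ext (funext h)⟩

variable (F j) in
/-- `t` is a function from tuples of elements of `G(N)` to `G(N)` that is definable with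
parameters from `M`. -/
def DefFun {α : Type*} (t : (α → F.Points N) → F.Points N) : Prop :=
  F.DefRel j fun z : Option α → F.Points N => z none = t fun a => z (some a)

/-- The values of the functions are quantified out; finiteness of `β` keeps this first-order. -/
theorem DefRel.subst [Finite β] {P : (β → F.Points N) → Prop} (h : F.DefRel j P)
    {t : β → (α → F.Points N) → F.Points N} (ht : ∀ b, F.DefFun j (t b)) :
    F.DefRel j fun x => P fun b => t b x := by
  have h1 : F.DefRel j fun x => ∃ y : β → F.Points N, (∀ b, y b = t b x) ∧ P y := by
    refine DefRel.exTuple (P := fun x y => (∀ b, y b = t b x) ∧ P y) (DefRel.and ?_ ?_)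
    · exact DefRel.all_finite fun b =>
        (ht b).reindex fun o : Option α => o.elim (Sum.inr b) Sum.inl
    · exact h.reindex Sum.inr
  refine h1.congr fun x => ⟨fun h => ⟨_, fun _ => rfl, h⟩, ?_⟩
  rintro ⟨y, hy, h⟩
  rwa [← show y = _ from funext hy]

theorem DefFun.proj (a : α) : F.DefFun j fun x => x a :=
  defRel_eq (none : Option α) (some a)

theorem DefRel.mem {X : Set (F.Points N)} (hX : F.IsDef j X)
    {t : (α → F.Points N) → F.Points N} (ht : F.DefFun j t) :
    F.DefRel j fun x => t x ∈ X := by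
  obtain ⟨θ, rfl⟩ := hX
  have h : F.DefRel j fun x : Unit → F.Points N => x () ∈ F.defSet j θ := by
    refine ⟨θ.relabel (Sum.map id fun i => ((), i)), fun x => ?_⟩
    rw [Formula.realize_relabel]
    refine iff_of_eq (congrArg θ.Realize ?_)
    ext (m | q) <;> rfl
  exact h.subst (t := fun _ => t) fun _ => ht

theorem isDef_iff {X : Set (F.Points N)} :
    F.IsDef j X ↔ F.DefRel j fun x : Unit → F.Points N => x () ∈ X := by
  refine ⟨fun h => DefRel.mem h (.proj ()), fun ⟨φ, hφ⟩ => ?_⟩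
  refine ⟨φ.relabel (Sum.map id Prod.snd), Set.ext fun a => ?_⟩
  refine (hφ fun _ => a).trans ?_
  change _ ↔ Formula.Realize _ _
  rw [Formula.realize_relabel]
  exact iff_of_eq (congrArg _ (by ext (m | q) <;> rfl))

theorem isDef_of_rel {X : Set (F.Points N)}
    (h : F.DefRel j fun x : Unit → F.Points N => x () ∈ X) : F.IsDef j X := isDef_iff.2 h

theorem isDef_univ : F.IsDef j (Set.univ : Set (F.Points N)) :=
  ⟨⊤, Set.ext fun _ => ⟨fun _ => Formula.realize_top.2 trivial, fun _ => trivial⟩⟩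

variable {X Y : Set (F.Points N)}

theorem IsDef.compl (hX : F.IsDef j X) : F.IsDef j Xᶜ :=
  isDef_of_rel (isDef_iff.1 hX).not

theorem IsDef.inter (hX : F.IsDef j X) (hY : F.IsDef j Y) : F.IsDef j (X ∩ Y) :=
  isDef_of_rel ((isDef_iff.1 hX).and (isDef_iff.1 hY))

theorem IsDef.union (hX : F.IsDef j X) (hY : F.IsDef j Y) : F.IsDef j (X ∪ Y) :=
  isDef_of_rel ((isDef_iff.1 hX).or (isDef_iff.1 hY))

theorem DefRel.eq {s t : (α → F.Points N) → F.Points N} (hs : F.DefFun j s)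
    (ht : F.DefFun j t) : F.DefRel j fun x => s x = t x :=
  (defRel_eq (F := F) (j := j) false true).subst (t := fun b : Bool => bif b then t else s)
    fun b => by cases b <;> assumption

end Closure

section Group

variable [F.GroupIn M] [F.GroupIn N] {α : Type*}

theorem DefFun.const (g : F.Points M) : F.DefFun j fun _ : α → F.Points N => F.incl j g := by
  refine ⟨Formula.iInf fun i : Fin F.dim =>
    Term.equal (Term.var (Sum.inr (none, i))) (Term.var (Sum.inl (g.coords i))), fun x => ?_⟩
  simp only [Formula.realize_iInf, Formula.realize_equal, Term.realize_var, valuation,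
    Sum.elim_inr, Sum.elim_inl]
  exact ⟨fun h i => by rw [h]; rfl, fun h => Points.ext (funext h)⟩

theorem defRel_mul (a b c : α) : F.DefRel j fun x => x a = x b * x c := by
  refine ⟨F.mul.relabel (Sum.elim (fun i => Sum.inr (b, i))
    (Sum.elim (fun i => Sum.inr (c, i)) fun i => Sum.inr (a, i))), fun x => ?_⟩
  rw [Formula.realize_relabel]
  refine (eq_comm.trans (GroupIn.mul_iff _ _ _).symm).trans ?_
  refine iff_of_eq (congrArg _ ?_)
  ext (i | i | i) <;> rfl

theorem DefFun.mul {s t : (α → F.Points N) → F.Points N} (hs : F.DefFun j s)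
    (ht : F.DefFun j t) : F.DefFun j fun x => s x * t x := by
  have h : F.DefRel j fun z : Option α → F.Points N => ∃ y : Bool → F.Points N,
      (y false = s (fun a => z (some a)) ∧ y true = t fun a => z (some a)) ∧
        z none = y false * y true :=
    DefRel.exTuple (P := fun z y => (y false = s (fun a => z (some a)) ∧
      y true = t fun a => z (some a)) ∧ z none = y false * y true)
      (((hs.reindex fun o : Option α => o.elim (Sum.inr false) fun a => Sum.inl (some a)).and
        (ht.reindex fun o : Option α => o.elim (Sum.inr true) fun a => Sum.inl (some a))).and
        (defRel_mul _ _ _))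
  refine h.congr fun z => ⟨fun h => ⟨fun b => bif b then _ else _, ⟨rfl, rfl⟩, h⟩, ?_⟩
  rintro ⟨y, ⟨h1, h2⟩, h3⟩
  rw [h3, h1, h2]

theorem DefFun.inv {t : (α → F.Points N) → F.Points N} (ht : F.DefFun j t) :
    F.DefFun j fun x => (t x)⁻¹ := by
  have h : F.DefRel j fun z : Option α → F.Points N => ∃ y : Bool → F.Points N,
      (y false = t (fun a => z (some a)) ∧ y true = F.incl j 1) ∧
        y true = z none * y false :=
    DefRel.exTuple (P := fun z y => (y false = t (fun a => z (some a)) ∧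
      y true = F.incl j 1) ∧ y true = z none * y false)
      (((ht.reindex fun o : Option α => o.elim (Sum.inr false) fun a => Sum.inl (some a)).and
        ((DefFun.const (α := Empty) 1).reindex fun o : Option Empty =>
          o.elim (Sum.inr true) Empty.elim)).and
        (defRel_mul _ _ _))
  refine h.congr fun z => ⟨fun h => ⟨fun b => bif b then 1 else _, ⟨rfl, (map_one _).symm⟩, ?_⟩, ?_⟩
  · simp [h]
  · rintro ⟨y, ⟨h1, h2⟩, h3⟩
    rw [h2, map_one, h1] at h3
    exact eq_inv_of_mul_eq_one_left h3.symm

/-- A nonempty `M`-definable relation holds at some tuple of elements of `G(M)`. -/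
theorem DefRel.exists_incl [Finite α] {P : (α → F.Points N) → Prop} (h : F.DefRel j P)
    (hP : ∃ x, P x) : ∃ x : α → F.Points M, P fun a => F.incl j (x a) := by
  obtain ⟨φ, hφ⟩ := h
  obtain ⟨x, hx⟩ := hP
  have h1 : (F.exPoints α φ).Realize (j ∘ id) := (F.realize_exPoints φ _).2 ⟨x, (hφ x).1 hx⟩
  rw [j.map_formula, realize_exPoints] at h1
  obtain ⟨y, hy⟩ := h1
  refine ⟨y, (hφ _).2 ?_⟩
  rw [← j.map_formula] at hy
  convert hy using 1
  ext (m | q) <;> rfl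

/-- Elementarity in the form used throughout: statements proved by topology or measure in G(M) pass
to G(N). -/
theorem DefRel.forall_of_incl [Finite α] {P : (α → F.Points N) → Prop} (h : F.DefRel j P)
    (hP : ∀ x : α → F.Points M, P fun a => F.incl j (x a)) (x : α → F.Points N) : P x := by
  by_contra hx
  obtain ⟨y, hy⟩ := h.not.exists_incl ⟨x, hx⟩
  exact hy (hP y)

theorem IsDef.exists_incl {X : Set (F.Points N)} (hX : F.IsDef j X) (h : X.Nonempty) :
    ∃ g : F.Points M, F.incl j g ∈ X := by
  obtain ⟨a, ha⟩ := h
  obtain ⟨x, hx⟩ := (isDef_iff.1 hX).exists_incl ⟨fun _ => a, ha⟩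
  exact ⟨x (), hx⟩

variable {X Y : Set (F.Points N)}

theorem IsDef.inv (hX : F.IsDef j X) : F.IsDef j X⁻¹ :=
  isDef_of_rel (DefRel.mem hX (DefFun.proj ()).inv)

theorem IsDef.mul (hX : F.IsDef j X) (hY : F.IsDef j Y) : F.IsDef j (X * Y) := by
  have h : F.DefRel j fun x : Unit → F.Points N => ∃ a, a ∈ X ∧ a⁻¹ * x () ∈ Y :=
    DefRel.ex (P := fun a x => a ∈ X ∧ a⁻¹ * x () ∈ Y)
      ((DefRel.mem hX (.proj none)).and
        (DefRel.mem hY ((DefFun.proj none).inv.mul (.proj (some ())))))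
  refine isDef_of_rel (h.congr fun x => ⟨?_, ?_⟩)
  · rintro ⟨a, ha, b, hb, hx⟩
    exact ⟨a, ha, by rw [← hx]; simpa using hb⟩
  · rintro ⟨a, ha, hb⟩
    exact ⟨a, ha, _, hb, by simp⟩

theorem IsDef.smul (hX : F.IsDef j X) (g : F.Points M) : F.IsDef j (F.incl j g • X) :=
  isDef_of_rel ((DefRel.mem hX ((DefFun.const g).inv.mul (.proj ()))).congr fun x => by
    rw [Set.mem_smul_set_iff_inv_smul_mem, smul_eq_mul])

theorem IsDef.pow (hX : F.IsDef j X) (n : ℕ) : F.IsDef j (X ^ n) := by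
  induction n with
  | zero =>
    refine isDef_of_rel (((DefRel.eq (DefFun.proj ()) (DefFun.const 1))).congr fun x => ?_)
    rw [pow_zero, Set.mem_one, map_one]
  | succ n ih => exact pow_succ X n ▸ ih.mul hX

/-- The largest subset `Y` of `G(N)` such that `U * Y ⊆ X`. -/
theorem IsDef.residual {U X : Set (F.Points N)} (hU : F.IsDef j U) (hX : F.IsDef j X) :
    F.IsDef j {b | ∀ a, a ∈ U → a * b ∈ X} :=
  isDef_of_rel (DefRel.all (P := fun a x => a ∈ U → a * x () ∈ X)
    ((DefRel.mem hU (.proj none)).imp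
      (DefRel.mem hX ((DefFun.proj none).mul (.proj (some ()))))))

theorem isDef_biInter_finset {ι : Type*} (s : Finset ι) {X : ι → Set (F.Points N)}
    (h : ∀ i ∈ s, F.IsDef j (X i)) : F.IsDef j (⋂ i ∈ s, X i) := by
  classical
  induction s using Finset.induction_on with
  | empty => simpa using isDef_univ
  | insert a s ha ih =>
    rw [Finset.set_biInter_insert]
    exact (h _ (by simp)).inter (ih fun i hi => h i (by simp [hi]))

end Group

end Definability

end GroupFormulas

/-! ### Saturation for indexed parameters and for finite tuples. -/

section Saturation

variable {L : FirstOrder.Language.{u, v}} {M : Type w} {N : Type w'} [L.Structure N]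
  {κ : Cardinal.{w'}}

theorem IsMonster.aleph0_lt_lift (hN : IsMonster L M N κ) :
    Cardinal.lift.{w'} (2 ^ (ℵ₀ : Cardinal.{max u v w})) < Cardinal.lift.{max u v w} κ :=
  (Cardinal.lift_le.2 (Cardinal.power_le_power_left two_ne_zero le_add_self)).trans_lt hN.large

theorem IsMonster.continuum_lt (hN : IsMonster L M N κ) : 2 ^ (ℵ₀ : Cardinal.{w'}) < κ := by
  rw [← Cardinal.lift_lt.{w', max u v w}]
  simpa using hN.aleph0_lt_lift

theorem IsMonster.aleph0_le (hN : IsMonster L M N κ) : ℵ₀ ≤ κ :=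
  (Cardinal.cantor _).le.trans hN.continuum_lt.le

theorem IsMonster.mk_range_lt (hN : IsMonster L M N κ) (f : M → N) : #(Set.range f) < κ := by
  rw [← Cardinal.lift_lt.{w', max u v w}]
  refine lt_of_le_of_lt ?_ hN.large
  have h1 : Cardinal.lift.{max u v w} #(Set.range f) ≤ Cardinal.lift.{max u v w'} #M := by
    have := Cardinal.mk_range_le_lift (f := f)
    rw [← Cardinal.lift_le.{max u v}] at this
    simpa using this
  refine h1.trans ?_
  have h2 : Cardinal.lift.{max u v} #M ≤
      Cardinal.lift.{max u v} #M + Cardinal.lift.{w} L.card + ℵ₀ :=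
    le_self_add.trans le_self_add
  have h3 := Cardinal.lift_le.{w'}.2 (h2.trans (Cardinal.cantor _).le)
  simpa using h3

theorem IsKappaSaturated.exists_realize (h : IsKappaSaturated L N κ) {P : Type w'} (x : P → N)
    (hP : #P < κ) (Γ : Set (L.Formula (P ⊕ Unit)))
    (hΓ : ∀ Δ : Finset (L.Formula (P ⊕ Unit)), (Δ : Set (L.Formula (P ⊕ Unit))) ⊆ Γ →
      ∃ y : N, ∀ θ ∈ Δ, θ.Realize (Sum.elim x fun _ => y)) :
    ∃ y : N, ∀ θ ∈ Γ, θ.Realize (Sum.elim x fun _ => y) := by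
  classical
  let r : L.Formula (P ⊕ Unit) → L.Formula (Set.range x ⊕ Unit) :=
    fun θ => θ.relabel (Sum.map (Set.rangeFactorization x) id)
  have hr : ∀ θ y, (r θ).Realize (Sum.elim (fun a : Set.range x => (a : N)) fun _ => y) ↔
      θ.Realize (Sum.elim x fun _ => y) := fun θ y => by
    rw [Formula.realize_relabel]
    exact iff_of_eq (congrArg θ.Realize (by ext (p | q) <;> rfl))
  obtain ⟨y, hy⟩ := h (Set.range x) (Cardinal.mk_range_le.trans_lt hP) (r '' Γ) (by
    intro Δ hΔ
    obtain ⟨Δ', h1, rfl⟩ := Finset.subset_set_image_iff.1 hΔ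
    obtain ⟨y, hy⟩ := hΓ Δ' h1
    refine ⟨y, fun θ hθ => ?_⟩
    obtain ⟨θ', h2, rfl⟩ := Finset.mem_image.1 hθ
    exact (hr _ _).2 (hy _ h2))
  exact ⟨y, fun θ hθ => (hr _ _).1 (hy _ ⟨θ, hθ, rfl⟩)⟩

/-- Coordinates are realized one at a time. The first realizes the existential closures of all
finite parts of `Γ`, and then joins the parameters. -/
theorem IsKappaSaturated.exists_realize_fin (h : IsKappaSaturated L N κ) (hκ : ℵ₀ ≤ κ) (n : ℕ) :
    ∀ {P : Type w'} (x : P → N), #P < κ → ∀ Γ : Set (L.Formula (P ⊕ Fin n)),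
      (∀ Δ : Finset (L.Formula (P ⊕ Fin n)), (Δ : Set (L.Formula (P ⊕ Fin n))) ⊆ Γ →
        ∃ y : Fin n → N, ∀ θ ∈ Δ, θ.Realize (Sum.elim x y)) →
      ∃ y : Fin n → N, ∀ θ ∈ Γ, θ.Realize (Sum.elim x y) := by
  classical
  induction n with
  | zero =>
    intro P x _ Γ hΓ
    refine ⟨Fin.elim0, fun θ hθ => ?_⟩
    obtain ⟨y, hy⟩ := hΓ {θ} (by simpa using hθ)
    rw [Subsingleton.elim Fin.elim0 y]
    exact hy θ (by simp)
  | succ n ih =>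
    intro P x hP Γ hΓ
    let e : P ⊕ Fin (n + 1) → (P ⊕ Unit) ⊕ Fin n :=
      Sum.elim (fun p => .inl (.inl p)) (Fin.cases (.inl (.inr ())) .inr)
    have he : ∀ (θ : L.Formula (P ⊕ Fin (n + 1))) (a : N) (y : Fin n → N),
        (θ.relabel e).Realize (Sum.elim (Sum.elim x fun _ => a) y) ↔
          θ.Realize (Sum.elim x (Fin.cons a y)) := fun θ a y => by
      rw [Formula.realize_relabel]
      refine iff_of_eq (congrArg θ.Realize ?_)
      ext (p | q)
      · rfl
      · refine Fin.cases ?_ (fun i => ?_) q <;> rfl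
    let f : Finset (L.Formula (P ⊕ Fin (n + 1))) → L.Formula (P ⊕ Unit) := fun Δ =>
      Formula.iExs (Fin n) (Formula.iInf fun θ : Δ => θ.1.relabel e)
    have hf : ∀ Δ a, (f Δ).Realize (Sum.elim x fun _ => a) ↔
        ∃ y : Fin n → N, ∀ θ ∈ Δ, θ.Realize (Sum.elim x (Fin.cons a y)) := fun Δ a => by
      simp only [f, Formula.realize_iExs, Formula.realize_iInf, he, Subtype.forall]
    obtain ⟨a, ha⟩ := h.exists_realize x hP (f '' {Δ | (Δ : Set _) ⊆ Γ}) (by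
      intro Ξ hΞ
      obtain ⟨Ξ', h1, rfl⟩ := Finset.subset_set_image_iff.1 hΞ
      obtain ⟨y, hy⟩ := hΓ (Ξ'.biUnion id) (by
        intro θ hθ
        obtain ⟨Δ, h2, h3⟩ := Finset.mem_biUnion.1 (Finset.mem_coe.1 hθ)
        exact h1 h2 h3)
      refine ⟨y 0, fun θ hθ => ?_⟩
      obtain ⟨Δ, h2, rfl⟩ := Finset.mem_image.1 hθ
      refine (hf _ _).2 ⟨Fin.tail y, fun θ hθ => ?_⟩
      rw [Fin.cons_self_tail]
      exact hy θ (Finset.mem_biUnion.2 ⟨Δ, h2, hθ⟩))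
    have hP' : #(P ⊕ Unit) < κ := by
      rw [Cardinal.mk_sum]
      simpa using Cardinal.add_lt_of_lt hκ hP (Cardinal.one_lt_aleph0.trans_le hκ)
    obtain ⟨y, hy⟩ := ih (Sum.elim x fun _ => a) hP' ((Formula.relabel e) '' Γ) (by
      intro Ξ hΞ
      obtain ⟨Δ, h1, rfl⟩ := Finset.subset_set_image_iff.1 hΞ
      obtain ⟨y, hy⟩ := (hf Δ a).1 (ha _ ⟨Δ, h1, rfl⟩)
      refine ⟨y, fun θ hθ => ?_⟩
      obtain ⟨θ', h2, rfl⟩ := Finset.mem_image.1 hθ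
      exact (he _ _ _).2 (hy _ h2))
    exact ⟨Fin.cons a y, fun θ hθ => (he _ _ _).1 (hy _ ⟨θ, hθ, rfl⟩)⟩

end Saturation

namespace GroupFormulas

section Saturation

variable {L : FirstOrder.Language.{u, v}} {F : GroupFormulas L} {M : Type w} [L.Structure M]
  {N : Type w'} [L.Structure N] {j : M ↪ₑ[L] N} {κ : Cardinal.{w'}}

/-- Saturation for tuples of elements of `G(N)` and `M`-definable relations with fewer than `κ`
additional parameters. -/
theorem exists_forall_rel (hN : IsMonster L M N κ) {P : Type w'} (x : P → F.Points N)
    (hP : #P < κ) {β : Type*} [Finite β] {ι : Type*}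
    (R : ι → (P → F.Points N) → (β → F.Points N) → Prop)
    (hR : ∀ i, F.DefRel j fun z : P ⊕ β → F.Points N =>
      R i (fun p => z (.inl p)) fun b => z (.inr b))
    (hfin : ∀ s : Finset ι, ∃ y, ∀ i ∈ s, R i x y) : ∃ y, ∀ i, R i x y := by
  classical
  choose φ hφ using hR
  obtain ⟨n, ⟨e⟩⟩ := Finite.exists_equiv_fin (β × Fin F.dim)
  let A : Type w' := Set.range j ⊕ (P × Fin F.dim)
  let a : A → N := Sum.elim (fun m => m) fun q => (x q.1).coords q.2
  have hA : #A < κ := by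
    have h1 : #(P × Fin F.dim) < κ := by
      rw [Cardinal.mk_prod, Cardinal.lift_id', Cardinal.mk_fin, Cardinal.lift_natCast]
      exact Cardinal.mul_lt_of_lt hN.aleph0_le hP (Cardinal.natCast_lt_aleph0.trans_le hN.aleph0_le)
    rw [Cardinal.mk_sum, Cardinal.lift_id, Cardinal.lift_id]
    exact Cardinal.add_lt_of_lt hN.aleph0_le (hN.mk_range_lt j) h1
  let f : M ⊕ ((P ⊕ β) × Fin F.dim) → A ⊕ Fin n :=
    Sum.elim (fun m => .inl (.inl ⟨j m, m, rfl⟩)) fun q =>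
      q.1.elim (fun p => .inl (.inr (p, q.2))) fun b => .inr (e (b, q.2))
  have hf : ∀ i (y : β → F.Points N) (z : Fin n → N), (∀ b k, z (e (b, k)) = (y b).coords k) →
      (((φ i).relabel f).Realize (Sum.elim a z) ↔ R i x y) := fun i y z hz => by
    rw [Formula.realize_relabel]
    refine Iff.trans (iff_of_eq (congrArg (φ i).Realize ?_)) (hφ i (Sum.elim x y)).symm
    ext (m | ⟨p | b, k⟩)
    · rfl
    · rfl
    · exact hz b k
  -- The formulas G(y_b) are added to the type so that the realizing tuple consists of points of the
  -- group.
  let c : β → L.Formula (A ⊕ Fin n) := fun b => F.carrier.relabel fun k => .inr (e (b, k))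
  have hc : ∀ b (z : Fin n → N), (c b).Realize (Sum.elim a z) ↔
      F.carrier.Realize fun k => z (e (b, k)) := fun b z => by
    rw [Formula.realize_relabel]; rfl
  obtain ⟨z, hz⟩ := hN.saturated.exists_realize_fin hN.aleph0_le n a hA
    (Set.range (Sum.elim c fun i => (φ i).relabel f)) (by
      intro Δ hΔ
      rw [← Set.image_univ] at hΔ
      obtain ⟨s, -, rfl⟩ := Finset.subset_set_image_iff.1 hΔ
      obtain ⟨y, hy⟩ := hfin (s.preimage Sum.inr Sum.inr_injective.injOn)
      have hz : ∀ b k, (fun q => (y (e.symm q).1).coords (e.symm q).2) (e (b, k)) =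
        (y b).coords k := by simp
      refine ⟨fun q => (y (e.symm q).1).coords (e.symm q).2, fun θ hθ => ?_⟩
      obtain ⟨b | i, h1, rfl⟩ := Finset.mem_image.1 hθ
      · refine (hc _ _).2 ?_
        simpa using (y b).realize
      · exact (hf i y _ hz).2 (hy i (Finset.mem_preimage.2 h1)))
  refine ⟨fun b => ⟨fun k => z (e (b, k)), (hc b z).1 (hz _ ⟨.inl b, rfl⟩)⟩, fun i => ?_⟩
  exact (hf i _ z fun _ _ => rfl).1 (hz _ ⟨.inr i, rfl⟩)

end Saturation

/-! ### Types over M, automorphisms and invariant sets. -/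

section Types

variable {L : FirstOrder.Language.{u, v}} {F : GroupFormulas L} {M : Type w} [L.Structure M]
  {N : Type w'} [L.Structure N] {j : M ↪ₑ[L] N} {κ : Cardinal.{w'}}

variable (F j) in
/-- `a` and `b` have the same type over `M`. -/
def SameType (a b : F.Points N) : Prop := ∀ X, F.IsDef j X → (a ∈ X ↔ b ∈ X)

theorem SameType.symm {a b : F.Points N} (h : F.SameType j a b) : F.SameType j b a :=
  fun X hX => (h X hX).symm

theorem sameType_of_imp {a b : F.Points N} (h : ∀ X, F.IsDef j X → a ∈ X → b ∈ X) :
    F.SameType j a b := fun X hX =>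
  ⟨h X hX, fun hb => by_contra fun ha => h Xᶜ hX.compl ha hb⟩

/-- Elements of `G(N)` with the same type over `M` are conjugate under `Aut(N/M)`. -/
theorem SameType.exists_automorphism (hN : IsMonster L M N κ) {a b : F.Points N}
    (h : F.SameType j a b) : ∃ σ : N ≃[L] N, (∀ m : M, σ (j m) = j m) ∧ b.1 = σ ∘ a.1 := by
  have key : ∀ θ : F.MFormula M, θ.Realize (Sum.elim j a.1) ↔ θ.Realize (Sum.elim j b.1) :=
    fun θ => h (F.defSet j θ) ⟨θ, rfl⟩
  let va : M ⊕ Fin F.dim → N := Sum.elim j a.1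
  let vb : M ⊕ Fin F.dim → N := Sum.elim j b.1
  have hA : #(Set.range va) < κ := by
    have h1 : Set.range va = Set.range j ∪ Set.range a.1 := Set.Sum.elim_range _ _
    rw [h1]
    refine (Cardinal.mk_union_le _ _).trans_lt
      (Cardinal.add_lt_of_lt hN.aleph0_le (hN.mk_range_lt j) ?_)
    exact (Cardinal.lt_aleph0_of_finite _).trans_le hN.aleph0_le
  choose s hs using fun x : Set.range va => x.2
  -- Equalities between entries belong to the type, so sending each entry of `va` to that of `vb` is
  -- well defined.
  have hs' : ∀ q, vb (s ⟨va q, q, rfl⟩) = vb q := fun q => by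
    have := key (Term.equal (Term.var (s ⟨va q, q, rfl⟩)) (Term.var q))
    simp only [Formula.realize_equal, Term.realize_var] at this
    exact this.1 (hs ⟨va q, q, rfl⟩)
  obtain ⟨σ, hσ⟩ := hN.homogeneous (Set.range va) hA (fun x => vb (s x)) (by
    intro θ
    have h1 := key (θ.relabel s)
    rw [Formula.realize_relabel, Formula.realize_relabel] at h1
    have h2 : Sum.elim j a.1 ∘ s = fun x : Set.range va => (x : N) := funext hs
    rw [h2] at h1
    exact h1)
  refine ⟨σ, fun m => (hσ ⟨va (.inl m), _, rfl⟩).trans (hs' (.inl m)), funext fun i => ?_⟩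
  exact ((hσ ⟨va (.inr i), _, rfl⟩).trans (hs' (.inr i))).symm

theorem IsInvariantOver.mem_of_sameType [F.GroupIn M] [F.GroupIn N] (hN : IsMonster L M N κ)
    {X : Set (F.Points N)} (hX : F.IsInvariantOver j X) {a b : F.Points N}
    (h : F.SameType j a b) (ha : a ∈ X) : b ∈ X := by
  obtain ⟨σ, h1, h2⟩ := h.exists_automorphism hN
  exact hX σ h1 a b h2 ha

theorem IsTypeDefinable.mem_of_sameType [F.GroupIn M] [F.GroupIn N]
    {X : Set (F.Points N)} (hX : F.IsTypeDefinable j X) {a b : F.Points N}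
    (h : F.SameType j a b) (ha : a ∈ X) : b ∈ X := by
  obtain ⟨Γ, rfl⟩ := hX
  rw [Set.mem_iInter₂] at ha ⊢
  exact fun θ hθ => (h _ ⟨θ, rfl⟩).1 (ha θ hθ)

theorem sameType_of_automorphism {a b : F.Points N} (σ : N ≃[L] N) (hσ : ∀ m : M, σ (j m) = j m)
    (h : b.1 = σ ∘ a.1) : F.SameType j a b := by
  rintro _ ⟨θ, rfl⟩
  change θ.Realize _ ↔ θ.Realize _
  have : Sum.elim j b.1 = σ ∘ Sum.elim j a.1 := by
    rw [h]
    ext (m | i)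
    · exact (hσ m).symm
    · rfl
  rw [this, StrongHomClass.realize_formula]

theorem IsTypeDefinable.isInvariantOver [F.GroupIn M] [F.GroupIn N]
    {X : Set (F.Points N)} (hX : F.IsTypeDefinable j X) : F.IsInvariantOver j X :=
  fun σ hσ _ _ hab ha => hX.mem_of_sameType (sameType_of_automorphism σ hσ hab) ha

end Types

/-! ### Coheirs and subgroups of bounded index. -/

section Lascar

variable {L : FirstOrder.Language.{u, v}} {F : GroupFormulas L} {M : Type w} [L.Structure M]
  {N : Type w'} [L.Structure N] {j : M ↪ₑ[L] N} {κ : Cardinal.{w'}} [F.GroupIn M] [F.GroupIn N]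

variable (F j) in
/-- `R` is a binary relation on `G(N)` definable over `M`. -/
abbrev DefRel₂ (R : F.Points N → F.Points N → Prop) : Prop :=
  F.DefRel j fun z : Bool → F.Points N => R (z false) (z true)

variable (j) in
/-- `c` realizes the coheir given by the ultrafilter `U` over `M` and the elements of `D`. -/
def RealizesCoheir (U : Ultrafilter (F.Points M)) (D : Set (F.Points N)) (c : F.Points N) : Prop :=
  ∀ R, F.DefRel₂ j R → ∀ d ∈ D, (∀ᶠ m in U, R (F.incl j m) d) → R c d

theorem RealizesCoheir.iff {U : Ultrafilter (F.Points M)} {D : Set (F.Points N)} {c : F.Points N}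
    (h : RealizesCoheir j U D c) {R : F.Points N → F.Points N → Prop} (hR : F.DefRel₂ j R)
    {d : F.Points N} (hd : d ∈ D) : R c d ↔ ∀ᶠ m in U, R (F.incl j m) d := by
  refine ⟨fun h1 => by_contra fun h2 => ?_, h R hR d hd⟩
  rw [← Ultrafilter.eventually_not] at h2
  exact h (fun x y => ¬ R x y) hR.not d hd h2 h1

/-- Any finitely many of the required conditions hold on a member of `U`, hence at a point of G(M).
-/
theorem exists_realizesCoheir (hN : IsMonster L M N κ) (U : Ultrafilter (F.Points M))
    (D : Set (F.Points N)) (hD : #D < κ) : ∃ c, RealizesCoheir j U D c := by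
  obtain ⟨y, hy⟩ := exists_forall_rel (F := F) (j := j) hN (fun d : D => (d : F.Points N)) hD
    (β := Unit) (ι := {q : (F.Points N → F.Points N → Prop) × D //
      F.DefRel₂ j q.1 ∧ ∀ᶠ m in U, q.1 (F.incl j m) q.2})
    (fun q x y => q.1.1 (y ()) (x q.1.2))
    (fun q => q.2.1.reindex fun b => bif b then Sum.inl q.1.2 else Sum.inr ()) (by
      intro s
      obtain ⟨m, hm⟩ := (Filter.eventually_all_finset s |>.2 fun q _ => q.2.2).exists
      exact ⟨fun _ => F.incl j m, hm⟩)
  exact ⟨y (), fun R hR d hd h => hy ⟨(R, ⟨d, hd⟩), hR, h⟩⟩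

/-- Types over a model are finitely satisfiable in it, so the traces on G(M) of the sets in tp(a/M)
have the finite intersection property. -/
theorem exists_ultrafilter_of_type (a : F.Points N) :
    ∃ U : Ultrafilter (F.Points M), ∀ X, F.IsDef j X → a ∈ X → ∀ᶠ m in U, F.incl j m ∈ X := by
  obtain ⟨U, hU⟩ := Ultrafilter.exists_ultrafilter_of_finite_inter_nonempty
    {Y : Set (F.Points M) | ∃ X, F.IsDef j X ∧ a ∈ X ∧ Y = F.incl j ⁻¹' X} (by
      intro T hT
      choose! X h1 h2 h3 using hT
      obtain ⟨g, hg⟩ := (isDef_biInter_finset T h1).exists_incl ⟨a, Set.mem_iInter₂.2 h2⟩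
      rw [Set.mem_iInter₂] at hg
      exact ⟨g, Set.mem_sInter.2 fun Y hY => by rw [h3 hY]; exact hg Y hY⟩)
  exact ⟨U, fun X hX ha => hU ⟨X, hX, ha, rfl⟩⟩

theorem RealizesCoheir.mem_iff {U : Ultrafilter (F.Points M)} {D : Set (F.Points N)}
    {c : F.Points N} (h : RealizesCoheir j U D c) (hD : D.Nonempty) {X : Set (F.Points N)}
    (hX : F.IsDef j X) : c ∈ X ↔ ∀ᶠ m in U, F.incl j m ∈ X := by
  obtain ⟨d, hd⟩ := hD
  exact h.iff (R := fun x _ => x ∈ X) (DefRel.mem hX (.proj false)) hd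

theorem RealizesCoheir.sameType {U : Ultrafilter (F.Points M)} {a : F.Points N}
    (hU : ∀ X, F.IsDef j X → a ∈ X → ∀ᶠ m in U, F.incl j m ∈ X) {D : Set (F.Points N)}
    {c : F.Points N} (h : RealizesCoheir j U D c) (hD : D.Nonempty) : F.SameType j a c :=
  sameType_of_imp fun X hX ha => (h.mem_iff hD hX).2 (hU X hX ha)

/-- Coheirs are M-invariant: whether R(c, a) holds is decided by R(m, a) for m in G(M), and so only
by the type of a over M. -/
theorem RealizesCoheir.inv_mul_sameType {U : Ultrafilter (F.Points M)} {D D' : Set (F.Points N)}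
    {a a' c c' : F.Points N} (h : RealizesCoheir j U D c) (ha : a ∈ D)
    (h' : RealizesCoheir j U D' c') (ha' : a' ∈ D') (haa' : F.SameType j a a') :
    F.SameType j (a⁻¹ * c) (a'⁻¹ * c') := by
  intro X hX
  have hR : F.DefRel₂ j fun x y => y⁻¹ * x ∈ X :=
    DefRel.mem hX ((DefFun.proj true).inv.mul (.proj false))
  refine (h.iff hR ha).trans (Iff.trans ?_ (h'.iff hR ha').symm)
  refine iff_of_eq (congrArg (fun Q : F.Points M → Prop => ∀ᶠ m in U, Q m) (funext fun m => ?_))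
  have hY : F.IsDef j {y | y⁻¹ * F.incl j m ∈ X} :=
    isDef_of_rel (DefRel.mem hX ((DefFun.proj ()).inv.mul (.const m)))
  exact propext (haa' _ hY)

/-- Otherwise build a sequence of length κ, each term realizing the coheir over a and the earlier
terms. All quotients of an earlier by a later term have the type of a⁻¹c, so they avoid H, and the
sequence represents κ cosets. -/
theorem RealizesCoheir.inv_mul_mem (hN : IsMonster L M N κ) {U : Ultrafilter (F.Points M)}
    {a c : F.Points N} (hU : ∀ X, F.IsDef j X → a ∈ X → ∀ᶠ m in U, F.incl j m ∈ X)
    {D : Set (F.Points N)} (hc : RealizesCoheir j U D c) (ha : a ∈ D)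
    {H : Subgroup (F.Points N)} (hH : ∀ a b, F.SameType j a b → a ∈ H → b ∈ H)
    (hind : #(F.Points N ⧸ H) < κ) : a⁻¹ * c ∈ H := by
  by_contra hac
  -- Made total so that it can drive a transfinite recursion; the default 1 for large `D` is never
  -- reached, as proper initial segments of `I` have fewer than κ elements.
  have hnext : ∀ D : Set (F.Points N), ∃ c, #D < κ → RealizesCoheir j U D c := fun D => by
    by_cases hD : #D < κ
    · obtain ⟨c, h⟩ := exists_realizesCoheir hN U D hD
      exact ⟨c, fun _ => h⟩
    · exact ⟨1, fun h => (hD h).elim⟩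
  choose next hnext using hnext
  let I := κ.ord.ToType
  let s : I → F.Points N := WellFoundedLT.fix fun i s =>
    next (insert a (Set.range fun k : Set.Iio i => s k.1 k.2))
  let E : I → Set (F.Points N) := fun i => insert a (Set.range fun k : Set.Iio i => s k.1)
  have hs : ∀ i, s i = next (E i) := fun i => WellFoundedLT.fix_eq _ i
  have hE : ∀ i, RealizesCoheir j U (E i) (s i) := fun i => by
    rw [hs]
    refine hnext _ ((Cardinal.mk_insert_le).trans_lt (Cardinal.add_lt_of_lt hN.aleph0_le ?_
      (Cardinal.one_lt_aleph0.trans_le hN.aleph0_le)))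
    refine Cardinal.mk_range_le.trans_lt ?_
    have h := Cardinal.mk_Iio_lt i (by simp [I])
    rwa [Cardinal.mk_toType, Cardinal.card_ord] at h
  have hlt : ∀ i k, i < k → (s i)⁻¹ * s k ∉ H := fun i k hik h => by
    refine hac (hH _ _ ?_ h)
    exact (hE k).inv_mul_sameType (.inr ⟨⟨i, hik⟩, rfl⟩) hc ha
      (((hE i).sameType hU ⟨a, .inl rfl⟩).symm)
  have hinj : Function.Injective fun i => (QuotientGroup.mk (s i) : F.Points N ⧸ H) := by
    intro i k hik
    rcases lt_trichotomy i k with h | h | h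
    · exact (hlt i k h (QuotientGroup.eq.1 hik)).elim
    · exact h
    · exact (hlt k i h (QuotientGroup.eq.1 hik.symm)).elim
  have := Cardinal.mk_le_of_injective hinj
  rw [Cardinal.mk_toType, Cardinal.card_ord] at this
  exact this.not_gt hind

/-- If `H` is a subgroup of bounded index whose membership depends only on the type over `M`,
then elements with the same type over `M` lie in the same coset of `H`. -/
theorem inv_mul_mem_of_sameType (hN : IsMonster L M N κ) {H : Subgroup (F.Points N)}
    (hH : ∀ a b, F.SameType j a b → a ∈ H → b ∈ H) (hind : #(F.Points N ⧸ H) < κ)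
    {a b : F.Points N} (hab : F.SameType j a b) : a⁻¹ * b ∈ H := by
  obtain ⟨U, hU⟩ := exists_ultrafilter_of_type (F := F) (j := j) a
  -- One element `c`, a coheir realization over both `a` and `b`, lies in aH and in bH.
  obtain ⟨c, hc⟩ := exists_realizesCoheir hN U {a, b} (((Set.toFinite
    ({a, b} : Set (F.Points N))).lt_aleph0).trans_le hN.aleph0_le)
  have h1 := hc.inv_mul_mem hN hU (.inl rfl) hH hind
  have h2 := hc.inv_mul_mem (a := b) hN (fun X hX hb => hU X hX ((hab X hX).2 hb))
    (.inr rfl) hH hind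
  simpa using H.mul_mem h1 (H.inv_mem h2)

variable (F j) in
/-- The subgroup generated by the quotients of elements with the same type over `M`. -/
def typeSubgroup : Subgroup (F.Points N) :=
  Subgroup.closure {x | ∃ a b, F.SameType j a b ∧ x = a⁻¹ * b}

theorem SameType.inv_mul_mem {a b : F.Points N} (h : F.SameType j a b) :
    a⁻¹ * b ∈ F.typeSubgroup j :=
  Subgroup.subset_closure ⟨a, b, h, rfl⟩

/-- The back-and-forth step: a finite part of tp(c/Ma) is consistent by an existential statement in
tp(a/M), so it is also consistent over b. -/
theorem SameType.exists_extend (hN : IsMonster L M N κ) {a b : F.Points N} (h : F.SameType j a b)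
    (c : F.Points N) : ∃ d, ∀ R, F.DefRel₂ j R → R a c → R b d := by
  obtain ⟨y, hy⟩ := exists_forall_rel (F := F) (j := j) hN (fun _ : PUnit.{w' + 1} => b)
    (by simpa using Cardinal.one_lt_aleph0.trans_le hN.aleph0_le) (β := Unit)
    (ι := {R : F.Points N → F.Points N → Prop // F.DefRel₂ j R ∧ R a c})
    (fun R x y => R.1 (x ⟨⟩) (y ()))
    (fun R => R.2.1.reindex fun b => bif b then Sum.inr () else Sum.inl PUnit.unit) (by
      intro s
      have h1 : F.IsDef j {x | ∃ y, ∀ i : s, i.1.1 x y} := isDef_of_rel <|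
        DefRel.ex (P := fun y z => ∀ i : s, i.1.1 (z ()) y) <| DefRel.all_finite fun i =>
          i.1.2.1.reindex fun b => bif b then none else some ()
      obtain ⟨y, hy⟩ := (h _ h1).1 ⟨c, fun i => i.1.2.2⟩
      exact ⟨fun _ => y, fun i hi => hy ⟨i, hi⟩⟩)
  exact ⟨y (), fun R hR h => hy ⟨R, hR, h⟩⟩

/-- If (a, c) and (b, d) have the same type, then c⁻¹(a⁻¹b)c = (ac)⁻¹(bd)·(c⁻¹d)⁻¹ is a product of a
generator and the inverse of one. -/
theorem typeSubgroup_normal (hN : IsMonster L M N κ) : (F.typeSubgroup j).Normal := by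
  have key : ∀ x ∈ F.typeSubgroup j, ∀ c, c⁻¹ * x * c ∈ F.typeSubgroup j := by
    intro x hx
    induction hx using Subgroup.closure_induction with
    | mem x hx =>
      obtain ⟨a, b, h, rfl⟩ := hx
      intro c
      obtain ⟨d, hd⟩ := h.exists_extend hN c
      have h1 : F.SameType j (a * c) (b * d) := sameType_of_imp fun X hX hac =>
        hd (fun x y => x * y ∈ X) (DefRel.mem hX ((DefFun.proj false).mul (.proj true))) hac
      have h2 : F.SameType j c d := sameType_of_imp fun X hX hc =>
        hd (fun _ y => y ∈ X) (DefRel.mem hX (.proj true)) hc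
      have := mul_mem h1.inv_mul_mem (inv_mem h2.inv_mul_mem)
      convert this using 1
      group
    | one => intro c; simp
    | mul x y _ _ hx hy => intro c; convert mul_mem (hx c) (hy c) using 1; group
    | inv x _ hx => intro c; convert inv_mem (hx c) using 1; group
  exact ⟨fun x hx c => by simpa using key x hx c⁻¹⟩

theorem typeSubgroup_le (hN : IsMonster L M N κ) {H : Subgroup (F.Points N)}
    (hH : ∀ a b, F.SameType j a b → a ∈ H → b ∈ H) (hind : #(F.Points N ⧸ H) < κ) :
    F.typeSubgroup j ≤ H := by
  refine (Subgroup.closure_le _).2 ?_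
  rintro _ ⟨a, b, h, rfl⟩
  exact inv_mul_mem_of_sameType hN hH hind h

theorem typeSubgroup_le_component000 (hN : IsMonster L M N κ) :
    F.typeSubgroup j ≤ F.component000 j κ :=
  le_sInf fun _ hH => typeSubgroup_le hN (fun _ _ => hH.1.mem_of_sameType hN) hH.2

variable (F j κ) in
theorem component000_le_component00 : F.component000 j κ ≤ F.component00 j κ :=
  sInf_le_sInf fun _ hH => ⟨hH.1.isInvariantOver, hH.2⟩

end Lascar

/-! ### Infinitesimals, and the inclusion that needs no amenability. -/

section Infinitesimals

variable {L : FirstOrder.Language.{u, v}} {F : GroupFormulas L} {M : Type w} [L.Structure M]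
  {N : Type w'} [L.Structure N] {j : M ↪ₑ[L] N} {κ : Cardinal.{w'}} [F.GroupIn M] [F.GroupIn N]

/-- In a saturated model, the product of the intersections of two filtered families of
`M`-definable sets is the intersection of the products. -/
theorem mem_iInter_mul_iInter (hN : IsMonster L M N κ) {ι : Type*} {A B : ι → Set (F.Points N)}
    (hA : ∀ i, F.IsDef j (A i)) (hB : ∀ i, F.IsDef j (B i))
    (hdir : ∀ s : Finset ι, ∃ k, ∀ i ∈ s, A k ⊆ A i ∧ B k ⊆ B i) {x : F.Points N}
    (hx : ∀ i, x ∈ A i * B i) : x ∈ (⋂ i, A i) * ⋂ i, B i := by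
  obtain ⟨y, hy⟩ := exists_forall_rel (F := F) (j := j) hN (fun _ : PUnit.{w' + 1} => x)
    (by simpa using Cardinal.one_lt_aleph0.trans_le hN.aleph0_le) (β := Unit)
    (fun i x y => y () ∈ A i ∧ (y ())⁻¹ * x ⟨⟩ ∈ B i)
    (fun i => (DefRel.mem (hA i) (.proj _)).and
      (DefRel.mem (hB i) ((DefFun.proj _).inv.mul (.proj _)))) (by
      intro s
      obtain ⟨k, hk⟩ := hdir s
      obtain ⟨a, ha, b, hb, rfl⟩ := hx k
      refine ⟨fun _ => a, fun i hi => ⟨(hk i hi).1 ha, ?_⟩⟩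
      simpa using (hk i hi).2 hb)
  exact ⟨y (), Set.mem_iInter.2 fun i => (hy i).1, _, Set.mem_iInter.2 fun i => (hy i).2, by simp⟩

theorem defSetBase_eq_preimage (θ : F.MFormula M) :
    F.defSetBase θ = F.incl j ⁻¹' F.defSet j θ := by
  ext a
  change θ.Realize (Sum.elim id a.1) ↔ θ.Realize (Sum.elim j (j ∘ a.1))
  rw [← j.map_formula θ (Sum.elim id a.1)]
  exact iff_of_eq (congrArg θ.Realize (by ext (m | i) <;> rfl))

variable [TopologicalSpace (F.Points M)]

variable (F j) in
/-- `U` is the set of points in `G(N)` of an `M`-definable neighbourhood of the identity of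
`G(M)`. -/
def IsDefNhd (U : Set (F.Points N)) : Prop :=
  F.IsDef j U ∧ F.incl j ⁻¹' U ∈ 𝓝 (1 : F.Points M)

theorem mem_infinitesimals_iff {a : F.Points N} :
    a ∈ F.infinitesimals j ↔ ∀ U, F.IsDefNhd j U → a ∈ U := by
  constructor
  · rintro h _ ⟨⟨θ, rfl⟩, hU⟩
    exact h θ (by rwa [defSetBase_eq_preimage (j := j)])
  · intro h θ hθ
    exact h _ ⟨⟨θ, rfl⟩, by rwa [← defSetBase_eq_preimage]⟩

theorem IsDefNhd.one_mem {U : Set (F.Points N)} (hU : F.IsDefNhd j U) : 1 ∈ U := by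
  have := mem_of_mem_nhds hU.2
  rwa [Set.mem_preimage, map_one] at this

theorem isDefNhd_univ : F.IsDefNhd j Set.univ := ⟨isDef_univ, Filter.univ_mem⟩

theorem IsDefNhd.inter {U V : Set (F.Points N)} (hU : F.IsDefNhd j U) (hV : F.IsDefNhd j V) :
    F.IsDefNhd j (U ∩ V) := ⟨hU.1.inter hV.1, Filter.inter_mem hU.2 hV.2⟩

theorem isDefNhd_biInter_finset {ι : Type*} (s : Finset ι) {U : ι → Set (F.Points N)}
    (h : ∀ i ∈ s, F.IsDefNhd j (U i)) : F.IsDefNhd j (⋂ i ∈ s, U i) := by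
  refine ⟨isDef_biInter_finset s fun i hi => (h i hi).1, ?_⟩
  rw [Set.preimage_iInter₂]
  exact (Filter.biInter_finset_mem s).2 fun i hi => (h i hi).2

variable [IsTopologicalGroup (F.Points M)]

theorem IsDefNhd.inv {U : Set (F.Points N)} (hU : F.IsDefNhd j U) : F.IsDefNhd j U⁻¹ := by
  refine ⟨hU.1.inv, ?_⟩
  have h : F.incl j ⁻¹' U⁻¹ = (F.incl j ⁻¹' U)⁻¹ := by ext a; simp
  rw [h]
  exact inv_mem_nhds_one _ hU.2

theorem IsDefNhd.conj {U : Set (F.Points N)} (hU : F.IsDefNhd j U) (g : F.Points M) :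
    F.IsDefNhd j {a | F.incl j g * a * (F.incl j g)⁻¹ ∈ U} := by
  refine ⟨isDef_of_rel (DefRel.mem hU.1
    (((DefFun.const g).mul (.proj ())).mul (DefFun.const g).inv)), ?_⟩
  have hc : Continuous fun x : F.Points M => g * x * g⁻¹ := by fun_prop
  have h1 : (fun x : F.Points M => g * x * g⁻¹) ⁻¹' (F.incl j ⁻¹' U) ∈ 𝓝 (1 : F.Points M) :=
    hc.continuousAt.preimage_mem_nhds (by simpa using hU.2)
  filter_upwards [h1] with x hx
  simpa using hx

/-- Continuity of multiplication gives the inclusion in G(M); a definable basis makes it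
first-order, so it transfers to G(N). -/
theorem IsDefNhd.exists_mul_subset (hb : F.HasDefinableNhdsBasis M) {U : Set (F.Points N)}
    (hU : F.IsDefNhd j U) : ∃ V, F.IsDefNhd j V ∧ V⁻¹ = V ∧ V * V ⊆ U := by
  obtain ⟨W, hW, hWU⟩ : ∃ W ∈ 𝓝 (1 : F.Points M), W * W ⊆ F.incl j ⁻¹' U := by
    obtain ⟨W, hWo, hW1, hW⟩ := exists_open_nhds_one_mul_subset hU.2
    exact ⟨W, hWo.mem_nhds hW1, hW⟩
  obtain ⟨θ, hθ, hθW⟩ := hb W hW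
  rw [defSetBase_eq_preimage (j := j)] at hθ hθW
  have hV : F.IsDefNhd j (F.defSet j θ) := ⟨⟨θ, rfl⟩, hθ⟩
  refine ⟨F.defSet j θ ∩ (F.defSet j θ)⁻¹, hV.inter hV.inv, by simp [Set.inter_comm], ?_⟩
  refine (Set.mul_subset_mul Set.inter_subset_left Set.inter_subset_left).trans ?_
  rintro _ ⟨a, ha, b, hb, rfl⟩
  have hD : F.IsDef j (F.defSet j θ) := hV.1
  exact ((DefRel.mem hD (.proj false)).and (DefRel.mem hD (.proj true)) |>.imp
    (DefRel.mem hU.1 ((DefFun.proj false).mul (.proj true)))).forall_of_incl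
    (fun x hx => by
      rw [← map_mul]
      exact hWU ⟨_, hθW hx.1, _, hθW hx.2, rfl⟩) (fun i : Bool => bif i then b else a) ⟨ha, hb⟩

/-- The infinitesimals form a subgroup when the identity has a basis of definable
neighbourhoods. -/
def infinitesimalSubgroup (j : M ↪ₑ[L] N) (hb : F.HasDefinableNhdsBasis M) :
    Subgroup (F.Points N) where
  carrier := F.infinitesimals j
  mul_mem' {a b} ha hb' := by
    rw [mem_infinitesimals_iff] at *
    intro U hU
    obtain ⟨V, hV, -, hVU⟩ := hU.exists_mul_subset hb
    exact hVU ⟨a, ha V hV, b, hb' V hV, rfl⟩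
  one_mem' := mem_infinitesimals_iff.2 fun _ hU => hU.one_mem
  inv_mem' {a} ha := by
    rw [mem_infinitesimals_iff] at *
    exact fun U hU => ha _ hU.inv

/-- An arbitrary g need not normalize μ, but each finite part of tp(g/M) is realized in G(M), whose
elements do. Saturation combines the two requirements. -/
theorem exists_conj_mem_infinitesimals (hN : IsMonster L M N κ) (g : F.Points N)
    {a : F.Points N} (ha : a ∈ F.infinitesimals j) :
    ∃ h, F.SameType j g h ∧ h * a * h⁻¹ ∈ F.infinitesimals j := by
  classical
  obtain ⟨y, hy⟩ := exists_forall_rel (F := F) (j := j) hN (fun _ : PUnit.{w' + 1} => a)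
    (by simpa using Cardinal.one_lt_aleph0.trans_le hN.aleph0_le) (β := Unit)
    (ι := {X // F.IsDef j X ∧ g ∈ X} × {U // F.IsDefNhd j U})
    (fun i x y => y () ∈ i.1.1 ∧ y () * x ⟨⟩ * (y ())⁻¹ ∈ i.2.1)
    (fun i => (DefRel.mem i.1.2.1 (.proj _)).and (DefRel.mem i.2.2.1
      (((DefFun.proj _).mul (.proj _)).mul (DefFun.proj _).inv))) (by
      intro s
      obtain ⟨h, hh⟩ := (isDef_biInter_finset s (X := fun i => i.1.1)
        fun i _ => i.1.2.1).exists_incl ⟨g, Set.mem_iInter₂.2 fun i _ => i.1.2.2⟩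
      refine ⟨fun _ => F.incl j h, fun i hi => ⟨Set.mem_iInter₂.1 hh i hi, ?_⟩⟩
      have := mem_infinitesimals_iff.1 (F.conj_mem_infinitesimals j h ha) i.2.1 i.2.2
      rwa [map_inv] at this)
  refine ⟨y (), sameType_of_imp fun X hX hg => (hy (⟨X, hX, hg⟩, ⟨_, isDefNhd_univ⟩)).1, ?_⟩
  exact mem_infinitesimals_iff.2 fun U hU => (hy (⟨_, isDef_univ, trivial⟩, ⟨U, hU⟩)).2

/-- With h of the type of g and hah⁻¹ in μ, the conjugate gag⁻¹ is that of hah⁻¹ by gh⁻¹, and gh⁻¹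
lies in J because J is normal. -/
theorem normalClosure_infinitesimals_le (hN : IsMonster L M N κ)
    (hb : F.HasDefinableNhdsBasis M) :
    Subgroup.normalClosure (F.infinitesimals j) ≤
      infinitesimalSubgroup j hb ⊔ F.typeSubgroup j := by
  have hJ := typeSubgroup_normal (F := F) (j := j) hN
  refine (Subgroup.closure_le _).2 fun x hx => ?_
  obtain ⟨a, ha, hax⟩ := Group.mem_conjugatesOfSet_iff.1 hx
  obtain ⟨g, rfl⟩ := isConj_iff.1 hax
  obtain ⟨h, hgh, hh⟩ := exists_conj_mem_infinitesimals hN g ha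
  have h1 : g * h⁻¹ ∈ F.typeSubgroup j := by
    convert hJ.conj_mem _ (inv_mem hgh.inv_mul_mem) g using 1
    group
  have h2 : g * h⁻¹ ∈ infinitesimalSubgroup j hb ⊔ F.typeSubgroup j :=
    Subgroup.mem_sup_right h1
  have h3 : h * a * h⁻¹ ∈ infinitesimalSubgroup j hb ⊔ F.typeSubgroup j :=
    Subgroup.mem_sup_left hh
  rw [SetLike.mem_coe]
  convert mul_mem (mul_mem h2 h3) (inv_mem h2) using 1
  group

theorem component000DefTop_subset (hN : IsMonster L M N κ) (hb : F.HasDefinableNhdsBasis M) :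
    F.component000DefTop j κ ⊆ F.component00DefTop j κ := by
  have hJ := typeSubgroup_normal (F := F) (j := j) hN
  rintro _ ⟨x, hx, y, hy, rfl⟩
  have h1 := normalClosure_infinitesimals_le hN hb hx
  rw [← SetLike.mem_coe, Subgroup.mul_normal] at h1
  obtain ⟨a, ha, b, hb', rfl⟩ := h1
  refine ⟨a, ha, b * y, ?_, (mul_assoc _ _ _).symm⟩
  exact component000_le_component00 F j κ
    (mul_mem (typeSubgroup_le_component000 hN hb') hy)

end Infinitesimals

end GroupFormulas

/-! ### Covering a group by sets of elements that move a set little. -/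

section Measure

open MeasureTheory

/-- In a probability space on which a group acts preserving the measure, boundedly many
translates of `{g | ν (g Q ∩ Q) ≥ c}` cover the group, where the bound and `c > 0` depend only
on a positive lower bound for `ν Q`. -/
theorem exists_cover_of_measure_le {Γ : Type*} [Group Γ] {Ω : Type*} [MeasurableSpace Ω]
    [MulAction Γ Ω] (ν : Measure Ω) [IsProbabilityMeasure ν]
    (hinv : ∀ (g : Γ) (B : Set Ω), MeasurableSet B → ν.real (g • B) = ν.real B)
    {t : ℝ} (ht : 0 < t) :
    ∃ (K : ℕ) (c : ℝ), 0 < c ∧ ∀ Q : Set Ω, (∀ g : Γ, MeasurableSet (g • Q)) → t ≤ ν.real Q →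
      ∃ g : Fin K → Γ, ∀ x, ∃ i, c ≤ ν.real ((((g i)⁻¹ * x) • Q) ∩ Q) := by
  -- If no K elements gave a cover, K elements could be chosen greedily so that the translates of Q
  -- overlap pairwise in measure less than t/(2K). Each new translate would then add at least t/2 to
  -- the union, for a total of Kt/2 > 1.
  obtain ⟨K, hK⟩ := exists_nat_gt (2 / t)
  have hK0 : (0 : ℝ) < K := (by positivity : (0 : ℝ) < 2 / t).trans hK
  have hK2 : 2 < K * t := by rwa [div_lt_iff₀ ht] at hK
  refine ⟨K, t / (2 * K), by positivity, ?_⟩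
  intro Q hmeas htQ
  have hQ : MeasurableSet Q := by simpa using hmeas 1
  by_contra! hcon
  have step : ∀ n ≤ K, ∃ h : ℕ → Γ, ∀ k < n, ∀ i < k,
      ν.real ((((h i)⁻¹ * h k) • Q) ∩ Q) < t / (2 * K) := by
    intro n
    induction n with
    | zero => exact fun _ => ⟨1, fun k hk => (Nat.not_lt_zero _ hk).elim⟩
    | succ n ih =>
      intro hn
      obtain ⟨h, hh⟩ := ih (by omega)
      -- Only the values of `h` below `n` matter; the others pad the list to length `K`.
      obtain ⟨x, hx⟩ := hcon fun i => h i
      refine ⟨Function.update h n x, fun k hk i hi => ?_⟩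
      rw [Function.update_of_ne (by omega)]
      rcases Nat.lt_succ_iff_lt_or_eq.1 hk with hk | rfl
      · rw [Function.update_of_ne hk.ne]
        exact hh k hk i hi
      · rw [Function.update_self]
        exact hx ⟨i, by omega⟩
  obtain ⟨h, hh⟩ := step K le_rfl
  have hm : ∀ n, MeasurableSet (⋃ i ∈ Finset.range n, h i • Q) := fun n =>
    Finset.measurableSet_biUnion _ fun i _ => hmeas _
  have key : ∀ n ≤ K, n * (t / 2) ≤ ν.real (⋃ i ∈ Finset.range n, h i • Q) := by
    intro n
    induction n with
    | zero => simp
    | succ n ih =>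
      intro hn
      have h1 : ν.real (h n • Q ∩ ⋃ i ∈ Finset.range n, h i • Q) ≤ t / 2 := by
        rw [Set.inter_iUnion₂]
        refine (measureReal_biUnion_finset_le _ _).trans ?_
        have h2 : ∀ i ∈ Finset.range n, ν.real (h n • Q ∩ h i • Q) ≤ t / (2 * K) := by
          intro i hi
          have h3 : h n • Q ∩ h i • Q = h i • ((((h i)⁻¹ * h n) • Q) ∩ Q) := by
            rw [Set.smul_set_inter, smul_smul, mul_inv_cancel_left]
          rw [h3, hinv _ _ ((hmeas _).inter hQ)]
          exact (hh n (by omega) i (Finset.mem_range.1 hi)).le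
        refine (Finset.sum_le_sum h2).trans ?_
        rw [Finset.sum_const, Finset.card_range, nsmul_eq_mul]
        have : (n : ℝ) ≤ K := by exact_mod_cast (by omega : n ≤ K)
        calc (n : ℝ) * (t / (2 * K)) ≤ K * (t / (2 * K)) := by gcongr
          _ = t / 2 := by field_simp
      have h4 : ν.real (h n • Q \ ⋃ i ∈ Finset.range n, h i • Q) ≥ t / 2 := by
        have := measureReal_inter_add_sdiff (μ := ν) (s := h n • Q) (hm n)
        rw [hinv _ _ hQ] at this
        linarith
      have h5 : (⋃ i ∈ Finset.range (n + 1), h i • Q) =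
          (⋃ i ∈ Finset.range n, h i • Q) ∪ (h n • Q \ ⋃ i ∈ Finset.range n, h i • Q) := by
        rw [Finset.range_add_one, Finset.set_biUnion_insert, Set.union_sdiff_self, Set.union_comm]
      rw [h5, measureReal_union Set.disjoint_sdiff_right ((hmeas _).diff (hm n))
        (measure_ne_top _ _) (measure_ne_top _ _)]
      push_cast
      linarith [ih (by omega)]
  have h6 := (key K le_rfl).trans measureReal_le_one
  linarith

end Measure

namespace GroupFormulas

/-! ### A definable substitute for positive measure. -/

section Large

variable {L : FirstOrder.Language.{u, v}} {F : GroupFormulas L} {M : Type w} [L.Structure M]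
  {N : Type w'} [L.Structure N] {j : M ↪ₑ[L] N} [F.GroupIn M] [F.GroupIn N]

/-- A definable notion of largeness: `B` is `[]`-large if it is nonempty, and `k :: l`-large if
`k` translates of the set of all `g` for which `g B ∩ B` is `l`-large cover the group. -/
def Large {G : Type*} [Group G] : List ℕ → Set G → Prop
  | [], B => B.Nonempty
  | k :: l, B => ∃ g : Fin k → G, ∀ x, ∃ i, Large l ((((g i)⁻¹ * x) • B) ∩ B)

section

variable {G : Type*} [Group G]

theorem Large.mono {l : List ℕ} {B B' : Set G} (h : Large l B) (hB : B ⊆ B') : Large l B' := by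
  induction l generalizing B B' with
  | nil => exact Set.Nonempty.mono hB h
  | cons k l ih =>
    obtain ⟨g, hg⟩ := h
    exact ⟨g, fun x => (hg x).imp fun i hi =>
      ih hi (Set.inter_subset_inter (Set.smul_set_mono hB) hB)⟩

theorem Large.of_cons {k : ℕ} {l : List ℕ} {B : Set G} (h : Large (k :: l) B) : Large l B := by
  obtain ⟨g, hg⟩ := h
  obtain ⟨i, hi⟩ := hg 1
  exact hi.mono Set.inter_subset_right

theorem Large.nonempty {l : List ℕ} {B : Set G} (h : Large l B) : B.Nonempty := by
  induction l with
  | nil => exact h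
  | cons k l ih => exact ih h.of_cons

/-- The covering elements are conjugated by a. -/
theorem Large.smul {l : List ℕ} {B : Set G} (h : Large l B) (a : G) : Large l (a • B) := by
  induction l generalizing B with
  | nil => exact Set.Nonempty.smul_set h
  | cons k l ih =>
    obtain ⟨g, hg⟩ := h
    refine ⟨fun i => a * g i * a⁻¹, fun x => (hg (a⁻¹ * x * a)).imp fun i hi => ?_⟩
    have := ih hi
    rw [Set.smul_set_inter, smul_smul] at this
    rw [smul_smul]
    convert this using 3
    group

end

/-- For a fixed list only finitely many group quantifiers occur. The statement is uniform in
families over any finite parameter tuple because each step of the recursion adds parameters. -/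
theorem DefRel.large (l : List ℕ) : ∀ {α : Type} [Finite α]
    {B : (α → F.Points N) → Set (F.Points N)},
    (F.DefRel j fun z : Option α → F.Points N => z none ∈ B fun a => z (some a)) →
      F.DefRel j fun x => Large l (B x) := by
  induction l with
  | nil => exact fun h => DefRel.ex h
  | cons k l ih =>
    intro α _ B h
    refine DefRel.exTuple (β := Fin k) (P := fun x g => ∀ y, ∃ i,
      Large l ((((g i)⁻¹ * y) • B x) ∩ B x)) (DefRel.all (P := fun y z => ∃ i,
        Large l ((((z (Sum.inr i))⁻¹ * y) • B fun a => z (Sum.inl a)) ∩ B fun a => z (Sum.inl a)))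
        (DefRel.ex_finite fun i => ih (α := Option (α ⊕ Fin k))
          (B := fun z => ((((z (some (Sum.inr i)))⁻¹ * z none) • B fun a => z (some (Sum.inl a))) ∩
            B fun a => z (some (Sum.inl a)))) (DefRel.and ?_ ?_)))
    · refine (h.subst (t := fun o : Option α => o.elim
        (fun z : Option (Option (α ⊕ Fin k)) → F.Points N =>
          ((z (some (some (Sum.inr i))))⁻¹ * z (some none))⁻¹ * z none)
        fun a z => z (some (some (Sum.inl a)))) ?_).congr fun z => ?_
      · rintro (_ | a)
        · exact ((DefFun.proj _).inv.mul (.proj _)).inv.mul (.proj _)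
        · exact .proj _
      · exact Set.mem_smul_set_iff_inv_smul_mem
    · exact h.reindex fun o : Option α => o.elim none fun a => some (some (Sum.inl a))

theorem isDef_large (l : List ℕ) {B : Set (F.Points N)} (hB : F.IsDef j B) :
    F.IsDef j {g | Large l (g • B ∩ B)} := by
  refine isDef_of_rel (DefRel.large l (B := fun x : Unit → F.Points N => x () • B ∩ B) ?_)
  refine DefRel.and ?_ (DefRel.mem hB (.proj none))
  exact (DefRel.mem hB ((DefFun.proj (some ())).inv.mul (.proj none))).congr fun z =>
    Set.mem_smul_set_iff_inv_smul_mem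

end Large

/-! ### Measure models and the largeness of sets of positive measure. -/

section MeasureModel

open MeasureTheory

variable {L : FirstOrder.Language.{u, v}} {F : GroupFormulas L} {M : Type w} [L.Structure M]
  {N : Type w'} [L.Structure N] {j : M ↪ₑ[L] N} [F.GroupIn M] [F.GroupIn N]
  [TopologicalSpace (F.Points M)]

/-- A map `C` from the `M`-definable subsets of `G(N)` to the measurable subsets of a probability
space with a measure preserving action of `G(M)`, which is compatible with unions and with
translations, and which sends sets that are separated by a neighbourhood of the identity to
disjoint sets. -/
structure MeasureModel (j : M ↪ₑ[L] N) {Ω : Type*} [MeasurableSpace Ω]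
    [MulAction (F.Points M) Ω] (ν : Measure Ω) (C : Set (F.Points N) → Set Ω) : Prop where
  isProbabilityMeasure : IsProbabilityMeasure ν
  invariant : ∀ (g : F.Points M) (B : Set Ω), MeasurableSet B → ν.real (g • B) = ν.real B
  measurableSet : ∀ X, F.IsDef j X → MeasurableSet (C X)
  union : ∀ X Y, F.IsDef j X → F.IsDef j Y → C (X ∪ Y) = C X ∪ C Y
  univ : C Set.univ = Set.univ
  smul : ∀ g X, F.IsDef j X → C (F.incl j g • X) = g • C X
  meet : ∀ X Y U, F.IsDef j X → F.IsDef j Y → F.IsDefNhd j U → (C X ∩ C Y).Nonempty →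
    ((U * X) ∩ Y).Nonempty

namespace MeasureModel

variable {Ω : Type*} [MeasurableSpace Ω] [MulAction (F.Points M) Ω] {ν : Measure Ω}
  {C : Set (F.Points N) → Set Ω}

theorem mono (hC : MeasureModel j ν C) {X Y : Set (F.Points N)} (hX : F.IsDef j X)
    (hY : F.IsDef j Y) (h : X ⊆ Y) :
    C X ⊆ C Y := by
  rw [← Set.union_eq_right.2 h, hC.union X Y hX hY]
  exact Set.subset_union_left

theorem empty (hC : MeasureModel j ν C) : C ∅ = ∅ := by
  have h0 : F.IsDef j (∅ : Set (F.Points N)) := by simpa using isDef_univ.compl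
  by_contra h
  rw [← ne_eq, ← Set.nonempty_iff_ne_empty] at h
  simpa using hC.meet ∅ ∅ _ h0 h0 isDefNhd_univ (by simpa using h)

/-- The set `(C Yᶜ)ᶜ` acts as the interior of `C Y`. Unlike `C`, it commutes with intersections,
which is needed for gB ∩ B; the price is a thickening by `U`. -/
theorem subset_interior (hC : MeasureModel j ν C) {X Y U : Set (F.Points N)}
    (hX : F.IsDef j X) (hY : F.IsDef j Y)
    (hU : F.IsDefNhd j U) (h : U * X ⊆ Y) : C X ⊆ (C Yᶜ)ᶜ := by
  intro p hp hp'
  obtain ⟨a, ha, ha'⟩ := hC.meet X Yᶜ U hX hY.compl hU ⟨p, hp, hp'⟩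
  exact ha' (h ha)

/-- The covering lemma bounds the number of translates and the measure of the overlaps by t alone,
so the induction on n continues with the new bound c and yields one list valid for every B. -/
theorem exists_large_of_measure_le (hC : MeasureModel j ν C) (n : ℕ) :
    ∀ {t : ℝ}, 0 < t → ∃ l : List ℕ, l.length = n ∧
    ∀ B, F.IsDef j B → t ≤ ν.real (C Bᶜ)ᶜ → Large l B := by
  have := hC.isProbabilityMeasure
  induction n with
  | zero =>
    refine fun {t} ht => ⟨[], rfl, fun B _ htB => ?_⟩
    by_contra hB
    rw [Large, Set.not_nonempty_iff_eq_empty] at hB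
    rw [hB, Set.compl_empty, hC.univ, Set.compl_univ, measureReal_empty] at htB
    exact htB.not_gt ht
  | succ n ih =>
    intro t ht
    obtain ⟨K, c, hc, hK⟩ := exists_cover_of_measure_le ν hC.invariant ht
    obtain ⟨l, hl, hlB⟩ := ih hc
    refine ⟨K :: l, by simp [hl], fun B hB htB => ?_⟩
    have hsm : ∀ g : F.Points M, g • (C Bᶜ)ᶜ = (C (F.incl j g • B)ᶜ)ᶜ := fun g => by
      rw [Set.smul_set_compl, ← hC.smul g _ hB.compl, Set.smul_set_compl]
    obtain ⟨g, hg⟩ := hK (C Bᶜ)ᶜ (fun g => by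
      rw [hsm]; exact (hC.measurableSet _ (hB.smul g).compl).compl) htB
    have hrel : F.DefRel j fun x : Unit → F.Points N => ∃ i,
        Large l ((((F.incl j (g i))⁻¹ * x ()) • B) ∩ B) :=
      DefRel.ex_finite fun i => DefRel.subst (isDef_iff.1 (isDef_large l hB))
        fun _ => (DefFun.const (g i)).inv.mul (.proj ())
    -- The measure gives a cover of G(M) only; definability of largeness extends it to G(N).
    refine ⟨fun i => F.incl j (g i), fun x => hrel.forall_of_incl (fun x => ?_) fun _ => x⟩
    obtain ⟨i, hi⟩ := hg (x ())
    refine ⟨i, ?_⟩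
    rw [← map_inv, ← map_mul]
    refine hlB _ ((hB.smul _).inter hB) ?_
    rwa [Set.compl_inter, hC.union _ _ (hB.smul _).compl hB.compl, Set.compl_union, ← hsm]

end MeasureModel

end MeasureModel

/-! ### The stabilizer theorem. -/

section Stabilizer

open MeasureTheory

variable {L : FirstOrder.Language.{u, v}} {F : GroupFormulas L} {M : Type w} [L.Structure M]
  {N : Type w'} [L.Structure N] {j : M ↪ₑ[L] N} [F.GroupIn M] [F.GroupIn N]
  [TopologicalSpace (F.Points M)]

variable (j) in
/-- `S` is a symmetric `M`-definable neighbourhood of the identity, finitely many translates of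
which cover the group. -/
structure IsGenericNhd (S : Set (F.Points N)) : Prop where
  isDef : F.IsDef j S
  inv_eq : S⁻¹ = S
  nhd : ∃ V, F.IsDefNhd j V ∧ V ⊆ S
  generic : ∃ (k : ℕ) (g : Fin k → F.Points N), ∀ x, ∃ i, (g i)⁻¹ * x ∈ S

theorem IsGenericNhd.one_mem {S : Set (F.Points N)} (hS : IsGenericNhd j S) : 1 ∈ S := by
  obtain ⟨V, hV, hVS⟩ := hS.nhd
  exact hVS hV.one_mem

theorem DefFun.list_prod {α : Type*} (l : List α) :
    F.DefFun j fun x : α → F.Points N => (l.map x).prod := by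
  induction l with
  | nil => simpa using DefFun.const (F := F) (j := j) (α := α) 1
  | cons a l ih => simpa using (DefFun.proj a).mul ih

/-- An inclusion of a power of a definable set in a definable set can be checked on products of
elements of `G(M)`. -/
theorem IsDef.pow_subset {S Z : Set (F.Points N)} (hS : F.IsDef j S) (hZ : F.IsDef j Z) (m : ℕ)
    (h : ∀ l : List (F.Points M), l.length = m → (∀ g ∈ l, F.incl j g ∈ S) →
      F.incl j l.prod ∈ Z) : S ^ m ⊆ Z := by
  intro x hx
  obtain ⟨f, rfl⟩ := Set.mem_pow.1 hx
  have hrel : F.DefRel j fun x : Fin m → F.Points N =>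
      (∀ i, x i ∈ S) → ((List.finRange m).map x).prod ∈ Z :=
    (DefRel.all_finite fun i => DefRel.mem hS (.proj i)).imp
      (DefRel.mem hZ (DefFun.list_prod (List.finRange m)))
  rw [List.ofFn_eq_map]
  refine hrel.forall_of_incl (fun y hy => ?_) (fun i => (f i : F.Points N)) fun i => (f i).2
  have := h ((List.finRange m).map y) (by simp) (by simpa using hy)
  rwa [map_list_prod, List.map_map] at this

variable {Ω : Type*} [MeasurableSpace Ω] [MulAction (F.Points M) Ω] {ν : Measure Ω}
  {C : Set (F.Points N) → Set Ω}

/-- By elementarity the finitely many translating elements can be taken in G(M), under which the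
measure is invariant. -/
theorem IsGenericNhd.measure_pos (hC : MeasureModel j ν C) {S : Set (F.Points N)}
    (hS : IsGenericNhd j S) : 0 < ν.real (C S) := by
  have := hC.isProbabilityMeasure
  obtain ⟨k, hk⟩ := hS.generic
  have hrel : F.DefRel j fun g : Fin k → F.Points N => ∀ x, ∃ i, (g i)⁻¹ * x ∈ S :=
    DefRel.all (P := fun x g => ∃ i, (g i)⁻¹ * x ∈ S) (DefRel.ex_finite fun i =>
      DefRel.mem hS.isDef ((DefFun.proj _).inv.mul (.proj _)))
  obtain ⟨g, hg⟩ := hrel.exists_incl hk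
  have hunion : ∀ s : Finset (Fin k), F.IsDef j (⋃ i ∈ s, F.incl j (g i) • S) ∧
      C (⋃ i ∈ s, F.incl j (g i) • S) = ⋃ i ∈ s, g i • C S := by
    classical
    intro s
    induction s using Finset.induction_on with
    | empty => simpa using ⟨by simpa using isDef_univ.compl, hC.empty⟩
    | insert i s _ ih =>
      rw [Finset.set_biUnion_insert, Finset.set_biUnion_insert,
        hC.union _ _ (hS.isDef.smul _) ih.1, hC.smul _ _ hS.isDef, ih.2]
      exact ⟨(hS.isDef.smul _).union ih.1, rfl⟩
  have huniv : (⋃ i ∈ Finset.univ, F.incl j (g i) • S) = Set.univ :=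
    Set.eq_univ_of_forall fun x => by
      obtain ⟨i, hi⟩ := hg x
      exact Set.mem_iUnion₂.2 ⟨i, Finset.mem_univ _, Set.mem_smul_set_iff_inv_smul_mem.2 hi⟩
  have h1 := (hunion Finset.univ).2
  rw [huniv, hC.univ] at h1
  by_contra h0
  have h2 : ν.real (Set.univ : Set Ω) ≤ ∑ i : Fin k, ν.real (g i • C S) := by
    rw [h1]
    exact measureReal_biUnion_finset_le _ _
  have h3 : ν.real (C S) = 0 := le_antisymm (not_lt.1 h0) measureReal_nonneg
  simp_rw [hC.invariant _ _ (hC.measurableSet _ hS.isDef), h3] at h2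
  rw [probReal_univ, Finset.sum_const_zero] at h2
  exact zero_lt_one.not_ge h2

/-- The definable subsets of `D` that contain the product of a neighbourhood of the identity and
of an `l`-large set. -/
structure LargeIn (j : M ↪ₑ[L] N) (D : Set (F.Points N)) (l : List ℕ) (B : Set (F.Points N)) :
    Prop where
  subset : B ⊆ D
  isDef : F.IsDef j B
  large : ∃ U B₀, F.IsDefNhd j U ∧ F.IsDef j B₀ ∧ U * B₀ ⊆ B ∧ Large l B₀

/-- There are a length and a large set at which passing to a one step smaller large set does not
decrease the measure of the product with `X` by more than `ε`. -/
theorem exists_largeIn_almost_minimal (hC : MeasureModel j ν C) {D X : Set (F.Points N)}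
    {l : List ℕ} {ε : ℝ} (hε : 1 < l.length * ε) (hD : LargeIn j D l D) :
    ∃ i, ∃ h : i < l.length, ∃ B, LargeIn j D (l[i] :: l.drop (i + 1)) B ∧
      ∀ B', LargeIn j D (l.drop (i + 1)) B' → ν.real (C (B * X)) - ε ≤ ν.real (C (B' * X)) := by
  have := hC.isProbabilityMeasure
  by_contra! hcon
  -- If every step could lower the measure by more than ε, `l.length` steps starting from at most 1
  -- would make it negative.
  have step : ∀ i ≤ l.length, ∃ B, LargeIn j D (l.drop i) B ∧ ν.real (C (B * X)) ≤ 1 - i * ε := by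
    intro i
    induction i with
    | zero => exact fun _ => ⟨D, hD, by simp⟩
    | succ i ih =>
      intro hi
      obtain ⟨B, hB, hBε⟩ := ih (by omega)
      rw [List.drop_eq_getElem_cons (by omega)] at hB
      obtain ⟨B', hB', h⟩ := hcon i (by omega) B hB
      refine ⟨B', hB', ?_⟩
      push_cast
      linarith
  obtain ⟨B, -, hB⟩ := step _ le_rfl
  have : 0 ≤ ν.real (C (B * X)) := measureReal_nonneg
  linarith

/-- A triangle inequality: A \ ghA ⊆ (A \ gA) ∪ g(A \ hA). -/
theorem measure_diff_smul_le (hC : MeasureModel j ν C) {A : Set Ω}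
    (hA : ∀ g : F.Points M, MeasurableSet (g • A)) {ε : ℝ} {T : Set (F.Points M)}
    (hT : ∀ g ∈ T, ν.real (A \ g • A) ≤ ε) (l : List (F.Points M)) (hl : ∀ g ∈ l, g ∈ T) :
    ν.real (A \ l.prod • A) ≤ l.length * ε := by
  have := hC.isProbabilityMeasure
  have hA1 : MeasurableSet A := by simpa using hA 1
  induction l with
  | nil => simp
  | cons g l ih =>
    have h1 : A \ (g * l.prod) • A ⊆ (A \ g • A) ∪ g • (A \ l.prod • A) := by
      rw [Set.smul_set_sdiff, smul_smul]
      intro x hx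
      by_cases h : x ∈ g • A
      · exact .inr ⟨h, hx.2⟩
      · exact .inl ⟨hx.1, h⟩
    rw [List.prod_cons]
    refine (measureReal_mono h1).trans ((measureReal_union_le _ _).trans ?_)
    rw [hC.invariant _ _ (hA1.diff (hA _))]
    have h2 := ih fun g hg => hl g (List.mem_cons_of_mem _ hg)
    have h3 := hT g (hl g List.mem_cons_self)
    push_cast [List.length_cons]
    linarith

variable [IsTopologicalGroup (F.Points M)]

/-- A version of the stabilizer theorem of Massicot and Wagner. -/
theorem exists_isGenericNhd_pow_subset (hb : F.HasDefinableNhdsBasis M)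
    (hC : MeasureModel j ν C) {D U X Y : Set (F.Points N)} (hY : F.IsDef j Y)
    (hY0 : 0 < ν.real (C Y)) (hX : F.IsDef j X) (hX0 : 0 < ν.real (C X)) (hU : F.IsDefNhd j U)
    (hD : F.IsDef j D) (hUY : U * Y ⊆ D) (m : ℕ) :
    ∃ S, IsGenericNhd j S ∧ ∀ W, F.IsDefNhd j W → S ^ m ⊆ W * (D * X) * (D * X)⁻¹ := by
  have := hC.isProbabilityMeasure
  set r := ν.real (C X) with hr
  -- With this choice mε < r, and r is at most the measure of C(BX).
  let ε := r / (m + 1)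
  have hε : 0 < ε := by positivity
  obtain ⟨n, hn⟩ := exists_nat_gt (1 / ε)
  obtain ⟨l, rfl, hl⟩ := hC.exists_large_of_measure_le n hY0
  -- One factor of `U'` puts C Y inside the interior of U'Y, which makes U'Y large; the other is the
  -- margin required by `LargeIn`.
  obtain ⟨U', hU', -, hUU⟩ := hU.exists_mul_subset hb
  have hDl : LargeIn j D l D := by
    refine ⟨subset_rfl, hD, U', U' * Y, hU', hU'.1.mul hY, ?_, hl _ (hU'.1.mul hY) ?_⟩
    · rw [← mul_assoc]
      exact (Set.mul_subset_mul_right hUU).trans hUY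
    · exact measureReal_mono (hC.subset_interior hY (hU'.1.mul hY) hU' subset_rfl)
  obtain ⟨i, hi, B, hB, hmin⟩ := exists_largeIn_almost_minimal (X := X) hC
    ((div_lt_iff₀ hε).1 hn) hDl
  set l' := l.drop (i + 1)
  obtain ⟨V₀, B₀, hV₀, hB₀, hVB₀, hlarge⟩ := hB.large
  obtain ⟨V, hV, hVinv, hVV⟩ := hV₀.exists_mul_subset hb
  -- Defining S with the shrunken set `B₁` leaves a margin `V` inside `B`, so that gB ∩ B still
  -- contains a neighbourhood times a large set. As VV ⊆ V₀, also V·B₀ ⊆ B₁, which puts V inside S.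
  let B₁ : Set (F.Points N) := {b | ∀ a, a ∈ V → a * b ∈ B}
  have hB₁ : F.IsDef j B₁ := hV.1.residual hB.isDef
  have hVB : V * B₁ ⊆ B := by
    rintro _ ⟨a, ha, b, hb, rfl⟩
    exact hb a ha
  have hB₀₁ : ∀ v ∈ V, ∀ b ∈ B₀, v * b ∈ B₁ := fun v hv b hb a ha =>
    hVB₀ ⟨a * v, hVV ⟨a, ha, v, hv, rfl⟩, b, hb, mul_assoc _ _ _⟩
  have hB₀₁' : B₀ ⊆ B₁ := fun b hb => by simpa using hB₀₁ 1 hV.one_mem b hb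
  let S : Set (F.Points N) := {g | Large l' (g • B₁ ∩ B₁)}
  have hS : F.IsDef j S := isDef_large l' hB₁
  have hSinv : ∀ g ∈ S, g⁻¹ ∈ S := fun g hg => by
    have := Large.smul hg g⁻¹
    rw [Set.smul_set_inter, inv_smul_smul, Set.inter_comm] at this
    exact this
  have hVS : V ⊆ S := fun v hv => by
    refine hlarge.of_cons.mono fun b hb => ⟨?_, hB₀₁' hb⟩
    rw [Set.mem_smul_set_iff_inv_smul_mem]
    exact hB₀₁ _ (by rw [← hVinv]; simpa using hv) b hb
  obtain ⟨g, hg⟩ := hlarge.mono hB₀₁'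
  refine ⟨S, ⟨hS, ?_, ⟨V, hV, hVS⟩, _, g, hg⟩, fun W hW => ?_⟩
  · ext g
    exact ⟨fun h => by simpa using hSinv _ h, fun h => hSinv g h⟩
  have hBX : F.IsDef j (B * X) := hB.isDef.mul hX
  set A := C (B * X) with hA
  have hgA : ∀ g : F.Points M, g • A = C (F.incl j g • (B * X)) := fun g => (hC.smul g _ hBX).symm
  have hAm : ∀ g : F.Points M, MeasurableSet (g • A) := fun g => by
    rw [hgA]
    exact hC.measurableSet _ (hBX.smul g)
  have hrA : r ≤ ν.real A := by
    obtain ⟨b, hb⟩ := hB₀.exists_incl hlarge.nonempty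
    have hbB : F.incl j b ∈ B := hVB₀ ⟨1, hV₀.one_mem, _, hb, one_mul _⟩
    rw [hr, ← hC.invariant b _ (hC.measurableSet _ hX), ← hC.smul b _ hX]
    refine measureReal_mono (hC.mono (hX.smul b) hBX ?_)
    rintro _ ⟨x, hx, rfl⟩
    exact ⟨_, hbB, x, hx, rfl⟩
  have hSA : ∀ g ∈ F.incl j ⁻¹' S, ν.real (A \ g • A) ≤ ε := by
    intro g hg
    -- The margin on gB is a conjugate of V, a neighbourhood because g comes from G(M). Almost
    -- minimality of B then applies to gB ∩ B.
    have hlg : LargeIn j D l' (F.incl j g • B ∩ B) := by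
      refine ⟨Set.inter_subset_right.trans hB.subset, (hB.isDef.smul g).inter hB.isDef,
        V ∩ {a | F.incl j g⁻¹ * a * (F.incl j g⁻¹)⁻¹ ∈ V}, F.incl j g • B₁ ∩ B₁,
        hV.inter (hV.conj g⁻¹), (hB₁.smul g).inter hB₁, ?_, hg⟩
      rintro _ ⟨a, ⟨ha, ha'⟩, b, ⟨hb, hb'⟩, rfl⟩
      refine ⟨?_, hVB ⟨a, ha, b, hb', rfl⟩⟩
      rw [Set.mem_smul_set_iff_inv_smul_mem] at hb ⊢
      convert hVB ⟨_, ha', _, hb, rfl⟩ using 1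
      simp [mul_assoc]
    have h1 : C ((F.incl j g • B ∩ B) * X) ⊆ A ∩ g • A := by
      refine Set.subset_inter (hC.mono (hlg.isDef.mul hX) hBX
        (Set.mul_subset_mul_right Set.inter_subset_right)) ?_
      rw [hgA]
      refine hC.mono (hlg.isDef.mul hX) (hBX.smul g) ?_
      rw [← smul_mul_assoc]
      exact Set.mul_subset_mul_right Set.inter_subset_left
    have h2 := (hmin _ hlg).trans (measureReal_mono h1)
    have h3 := measureReal_inter_add_sdiff (μ := ν) (s := A) (hAm g)
    linarith
  have hZ : F.IsDef j (W * (D * X) * (D * X)⁻¹) := (hW.1.mul (hD.mul hX)).mul (hD.mul hX).inv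
  refine hS.pow_subset hZ m fun gs hgs hgsS => ?_
  have h1 := measure_diff_smul_le hC hAm hSA gs hgsS
  have h2 : (A ∩ gs.prod • A).Nonempty := by
    rw [Set.nonempty_iff_ne_empty]
    intro h0
    rw [(Set.disjoint_iff_inter_eq_empty.2 h0).sdiff_eq_left, hgs] at h1
    have h3 : m * ε < r := by
      have : (m + 1) * ε = r := by simp only [ε]; field_simp
      linarith
    linarith
  rw [hgA] at h2
  obtain ⟨_, ⟨w, hw, _, ⟨b, hb, x, hx, rfl⟩, rfl⟩, _, ⟨b', hb', x', hx', rfl⟩, h⟩ :=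
    hC.meet _ _ W hBX (hBX.smul _) hW h2
  refine ⟨w * (b * x), ⟨w, hw, _, ⟨b, hB.subset hb, x, hx, rfl⟩, rfl⟩, (b' * x')⁻¹, ?_, ?_⟩
  · exact Set.inv_mem_inv.2 ⟨b', hB.subset hb', x', hx', rfl⟩
  · have h3 : F.incl j gs.prod * (b' * x') = w * (b * x) := h
    exact mul_inv_eq_of_eq_mul h3.symm

end Stabilizer

/-! ### The component G^{00}_M and the comparison under a measure model. -/

section Component

open MeasureTheory

variable {L : FirstOrder.Language.{u, v}} {F : GroupFormulas L} {M : Type w} [L.Structure M]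
  {N : Type w'} [L.Structure N] {j : M ↪ₑ[L] N} {κ : Cardinal.{w'}} [F.GroupIn M] [F.GroupIn N]
  [TopologicalSpace (F.Points M)] [IsTopologicalGroup (F.Points M)]
  {Ω : Type*} [MeasurableSpace Ω] [MulAction (F.Points M) Ω] {ν : Measure Ω}
  {C : Set (F.Points N) → Set Ω}

/-- With X = Y = S, D = SS and W ⊆ S, the target W(DX)(DX)⁻¹ lies in S·S³·S³ = S^7. Taking m = 14 =
2·7 makes the step iterable. -/
theorem IsGenericNhd.exists_pow_subset (hb : F.HasDefinableNhdsBasis M) (hC : MeasureModel j ν C)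
    {S : Set (F.Points N)} (hS : IsGenericNhd j S) :
    ∃ S', IsGenericNhd j S' ∧ S' ^ 14 ⊆ S ^ 7 := by
  obtain ⟨V, hV, hVS⟩ := hS.nhd
  obtain ⟨S', hS', h⟩ := exists_isGenericNhd_pow_subset hb hC hS.isDef (hS.measure_pos hC)
    hS.isDef (hS.measure_pos hC) hV (hS.isDef.mul hS.isDef) (Set.mul_subset_mul_right hVS) 14
  refine ⟨S', hS', (h V hV).trans ?_⟩
  have h1 : (S * S * S)⁻¹ = S * S * S := by
    rw [mul_inv_rev, mul_inv_rev, hS.inv_eq, mul_assoc]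
  rw [h1]
  refine (Set.mul_subset_mul_right (Set.mul_subset_mul_right hVS)).trans (subset_of_eq ?_)
  simp only [pow_succ, pow_zero, one_mul, mul_assoc]

/-- Iteration gives generic sets S_n with S_{n+1}^7·S_{n+1}^7 ⊆ S_n^7, so the intersection of the
S_n^7 is a type-definable subgroup. -/
theorem IsGenericNhd.component00_subset (hN : IsMonster L M N κ) (hb : F.HasDefinableNhdsBasis M)
    (hC : MeasureModel j ν C) {S : Set (F.Points N)} (hS : IsGenericNhd j S) :
    (F.component00 j κ : Set (F.Points N)) ⊆ S ^ 7 := by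
  choose f hf using fun S : {S // IsGenericNhd j S} => S.2.exists_pow_subset hb hC
  let s : ℕ → {S // IsGenericNhd j S} := fun n => (fun S => ⟨f S, (hf S).1⟩)^[n] ⟨S, hS⟩
  have hs : ∀ n, (s (n + 1)).1 ^ 14 ⊆ (s n).1 ^ 7 := fun n => by
    simp only [s, Function.iterate_succ_apply']
    exact (hf _).2
  have hmul : ∀ n, ∀ a ∈ (s (n + 1)).1 ^ 7, ∀ b ∈ (s (n + 1)).1 ^ 7, a * b ∈ (s n).1 ^ 7 :=
    fun n a ha b hb => hs n (by
      rw [show 14 = 7 + 7 from rfl, pow_add]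
      exact ⟨a, ha, b, hb, rfl⟩)
  have hle : ∀ n, (s n).1 ⊆ (s n).1 ^ 7 := fun n => by
    simpa using Set.pow_subset_pow_right (s n).2.one_mem (show 1 ≤ 7 by norm_num)
  let H : Subgroup (F.Points N) :=
    { carrier := ⋂ n, (s n).1 ^ 7
      one_mem' := Set.mem_iInter.2 fun n => hle n (s n).2.one_mem
      mul_mem' := fun {a b} ha hb => Set.mem_iInter.2 fun n =>
        hmul n a (Set.mem_iInter.1 ha _) b (Set.mem_iInter.1 hb _)
      inv_mem' := fun {a} ha => Set.mem_iInter.2 fun n => by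
        rw [← (s n).2.inv_eq, inv_pow]
        exact Set.inv_mem_inv.2 (Set.mem_iInter.1 ha n) }
  have htype : F.IsTypeDefinable j (H : Set (F.Points N)) := by
    choose θ hθ using fun n => (s n).2.isDef.pow 7
    refine ⟨Set.range θ, ?_⟩
    rw [Set.biInter_range]
    exact Set.iInter_congr hθ
  have hindex : #(F.Points N ⧸ H) < κ := by
    choose k g hg using fun n => (s n).2.generic
    choose i hi using hg
    -- Two points in the same translate of S_{n+1} have their quotient in S_{n+1}·S_{n+1} ⊆ S_n^7.
    -- So a coset is determined by a sequence of natural numbers, and the index is at most the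
    -- continuum.
    let e : F.Points N ⧸ H → ℕ → ℕ := fun q n => i (n + 1) q.out
    have he : Function.Injective e := by
      intro q q' hqq
      rw [← q.out_eq', ← q'.out_eq']
      refine QuotientGroup.eq.2 (Set.mem_iInter.2 fun n => ?_)
      have h1 : i (n + 1) q.out = i (n + 1) q'.out := Fin.ext (congrFun hqq n)
      have h2 := hi (n + 1) q.out
      have h3 := hi (n + 1) q'.out
      rw [h1, ← (s (n + 1)).2.inv_eq, Set.mem_inv] at h2
      simpa using hmul n _ (hle _ h2) _ (hle _ h3)
    have h4 := Cardinal.lift_mk_le_lift_mk_of_injective he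
    refine lt_of_le_of_lt ?_ hN.continuum_lt
    simpa using h4
  have hH : F.component00 j κ ≤ H := sInf_le ⟨htype, hindex⟩
  exact (SetLike.coe_subset_coe.2 hH).trans (Set.iInter_subset _ 0)

/-- Finitely many definable sets of measure zero cannot cover G; saturation gives a point outside
all of them. -/
theorem MeasureModel.exists_generic_point (hN : IsMonster L M N κ) (hC : MeasureModel j ν C) :
    ∃ a : F.Points N, ∀ X, F.IsDef j X → a ∈ X → 0 < ν.real (C X) := by
  have := hC.isProbabilityMeasure
  classical
  obtain ⟨y, hy⟩ := exists_forall_rel (F := F) (j := j) hN (fun _ : PUnit.{w' + 1} => 1)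
    (by simpa using Cardinal.one_lt_aleph0.trans_le hN.aleph0_le) (β := Unit)
    (ι := {X // F.IsDef j X ∧ ν.real (C X) = 0})
    (fun X _ y => y () ∉ X.1) (fun X => (DefRel.mem X.2.1 (.proj _)).not) (by
      intro s
      by_contra! hcon
      have hunion : F.IsDef j (⋃ X ∈ s, X.1) ∧ ν.real (C (⋃ X ∈ s, X.1)) = 0 := by
        clear hcon
        induction s using Finset.induction_on with
        | empty =>
          simpa [hC.empty] using (isDef_univ (F := F) (j := j)).compl
        | insert X s _ ih =>
          rw [Finset.set_biUnion_insert, hC.union _ _ X.2.1 ih.1]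
          refine ⟨X.2.1.union ih.1, le_antisymm ((measureReal_union_le _ _).trans ?_)
            measureReal_nonneg⟩
          rw [X.2.2, ih.2, add_zero]
      have huniv : (⋃ X ∈ s, X.1) = Set.univ := Set.eq_univ_of_forall fun x => by
        obtain ⟨X, hX, hx⟩ := hcon fun _ => x
        exact Set.mem_iUnion₂.2 ⟨X, hX, hx⟩
      rw [huniv, hC.univ, probReal_univ] at hunion
      exact one_ne_zero hunion.2)
  refine ⟨y (), fun X hX ha => measureReal_nonneg.lt_of_ne fun h => ?_⟩
  exact hy ⟨X, hX, h.symm⟩ ha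

/-- Let p be the type of a generic point. The stabilizer theorem with D = UX and W = U, for X in p
and U a neighbourhood, puts the component in U(UXX)(UXX)⁻¹. Saturation commutes the products with
the intersection over all (X, U), and in G/K the sets μ and p become single points, so everything
cancels. -/
theorem component00_le (hN : IsMonster L M N κ) (hb : F.HasDefinableNhdsBasis M)
    (hC : MeasureModel j ν C) :
    F.component00 j κ ≤ Subgroup.normalClosure (F.infinitesimals j) ⊔ F.typeSubgroup j := by
  classical
  obtain ⟨a, ha⟩ := hC.exists_generic_point hN
  have hJ := typeSubgroup_normal (F := F) (j := j) hN
  set K := Subgroup.normalClosure (F.infinitesimals j) ⊔ F.typeSubgroup j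
  let ι := {X // F.IsDef j X ∧ a ∈ X} × {U // F.IsDefNhd j U}
  have hdir : ∀ s : Finset ι, ∃ k : ι, ∀ i ∈ s, k.1.1 ⊆ i.1.1 ∧ k.2.1 ⊆ i.2.1 := fun s =>
    ⟨(⟨⋂ i ∈ s, i.1.1, isDef_biInter_finset s fun i _ => i.1.2.1,
      Set.mem_iInter₂.2 fun i _ => i.1.2.2⟩,
      ⟨⋂ i ∈ s, i.2.1, isDefNhd_biInter_finset s fun i _ => i.2.2⟩),
      fun i hi => ⟨Set.biInter_subset_of_mem hi, Set.biInter_subset_of_mem hi⟩⟩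
  let A : ι → Set (F.Points N) := fun i => i.2.1 * (i.1.1 * i.1.1)
  have hA : ∀ i, F.IsDef j (A i) := fun i => i.2.2.1.mul (i.1.2.1.mul i.1.2.1)
  have hAmono : ∀ i k : ι, k.1.1 ⊆ i.1.1 ∧ k.2.1 ⊆ i.2.1 → A k ⊆ A i := fun i k h =>
    Set.mul_subset_mul h.2 (Set.mul_subset_mul h.1 h.1)
  have hinf : ∀ x, (x ∈ ⋂ i : ι, i.2.1) → (x : F.Points N ⧸ K) = 1 := fun x hx =>
    (QuotientGroup.eq_one_iff _).2 (Subgroup.mem_sup_left (Subgroup.subset_normalClosure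
      (mem_infinitesimals_iff.2 fun U hU =>
        Set.mem_iInter.1 hx (⟨_, isDef_univ, trivial⟩, ⟨U, hU⟩))))
  have htyp : ∀ x, (x ∈ ⋂ i : ι, i.1.1) → (x : F.Points N ⧸ K) = a := fun x hx =>
    (QuotientGroup.eq.2 (Subgroup.mem_sup_right (SameType.inv_mul_mem (sameType_of_imp
      fun X hX haX => Set.mem_iInter.1 hx (⟨X, hX, haX⟩, ⟨_, isDefNhd_univ⟩))))).symm
  have hAq : ∀ x ∈ ⋂ i, A i, (x : F.Points N ⧸ K) = a * a := by
    intro x hx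
    obtain ⟨u, hu, z, hz, rfl⟩ := mem_iInter_mul_iInter hN (fun i : ι => i.2.2.1)
      (fun i => i.1.2.1.mul i.1.2.1) (fun s => (hdir s).imp fun k hk i hi =>
        ⟨(hk i hi).2, Set.mul_subset_mul (hk i hi).1 (hk i hi).1⟩) (Set.mem_iInter.1 hx)
    obtain ⟨b, hb, c, hc, rfl⟩ := mem_iInter_mul_iInter hN (fun i : ι => i.1.2.1)
      (fun i => i.1.2.1) (fun s => (hdir s).imp fun k hk i hi =>
        ⟨(hk i hi).1, (hk i hi).1⟩) (Set.mem_iInter.1 hz)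
    simp only [QuotientGroup.mk_mul]
    rw [hinf u hu, htyp b hb, htyp c hc, one_mul]
  intro h hh
  have h1 : ∀ i : ι, h ∈ (i.2.1 * A i) * (A i)⁻¹ := fun i => by
    obtain ⟨S, hS, hSW⟩ := exists_isGenericNhd_pow_subset hb hC i.1.2.1 (ha _ i.1.2.1 i.1.2.2)
      i.1.2.1 (ha _ i.1.2.1 i.1.2.2) i.2.2 (i.2.2.1.mul i.1.2.1) subset_rfl 7
    have := hSW _ i.2.2 (hS.component00_subset hN hb hC hh)
    rwa [mul_assoc i.2.1 i.1.1 i.1.1] at this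
  obtain ⟨x, hx, y, hy, rfl⟩ := mem_iInter_mul_iInter hN (fun i : ι => i.2.2.1.mul (hA i))
    (fun i => (hA i).inv) (fun s => (hdir s).imp fun k hk i hi =>
      ⟨Set.mul_subset_mul (hk i hi).2 (hAmono i k (hk i hi)),
        Set.inv_subset_inv.2 (hAmono i k (hk i hi))⟩) h1
  obtain ⟨u, hu, z, hz, rfl⟩ := mem_iInter_mul_iInter hN (fun i : ι => i.2.2.1) hA
    (fun s => (hdir s).imp fun k hk i hi => ⟨(hk i hi).2, hAmono i k (hk i hi)⟩)
    (Set.mem_iInter.1 hx)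
  have hy' : y⁻¹ ∈ ⋂ i, A i := Set.mem_iInter.2 fun i => Set.mem_iInter.1 hy i
  refine (QuotientGroup.eq_one_iff _).1 ?_
  have h2 := hAq _ hy'
  rw [QuotientGroup.mk_inv, inv_eq_iff_eq_inv] at h2
  simp only [QuotientGroup.mk_mul]
  rw [hinf u hu, hAq z hz, h2, one_mul, mul_inv_cancel]

theorem component00DefTop_eq (hN : IsMonster L M N κ) (hb : F.HasDefinableNhdsBasis M)
    (hC : MeasureModel j ν C) : F.component00DefTop j κ = F.component000DefTop j κ := by
  refine Set.Subset.antisymm ?_ (component000DefTop_subset hN hb)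
  have hJ := typeSubgroup_normal (F := F) (j := j) hN
  rintro _ ⟨m, hm, h, hh, rfl⟩
  have h1 := component00_le hN hb hC hh
  rw [← SetLike.mem_coe, Subgroup.mul_normal] at h1
  obtain ⟨x, hx, y, hy, rfl⟩ := h1
  exact ⟨m * x, mul_mem (Subgroup.subset_normalClosure hm) hx, y,
    typeSubgroup_le_component000 hN hy, mul_assoc _ _ _⟩

end Component

/-! ### The measure model on S^μ_G(M). -/

section Ambit

open MeasureTheory

variable {L : FirstOrder.Language.{u, v}} {F : GroupFormulas L} {M : Type w} [L.Structure M]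
  {N : Type w'} [L.Structure N] {j : M ↪ₑ[L] N} {κ : Cardinal.{w'}} [F.GroupIn M] [F.GroupIn N]
  [TopologicalSpace (F.Points M)]

variable (j) in
/-- The point of `S_G^μ(M)` given by an element of `G(N)`. -/
def toAmbit (a : F.Points N) : F.Ambit j := Quotient.mk (F.infSetoid j) (F.tp j a)

theorem toAmbit_surjective : Function.Surjective (toAmbit (F := F) j) :=
  Quotient.mk_surjective.comp Quotient.mk_surjective

theorem tp_eq_iff {a b : F.Points N} : F.tp j a = F.tp j b ↔ F.SameType j a b := by
  refine Quotient.eq.trans ⟨?_, fun h θ => h _ ⟨θ, rfl⟩⟩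
  rintro h _ ⟨θ, rfl⟩
  exact h θ

theorem toAmbit_eq_iff {a b : F.Points N} : toAmbit j a = toAmbit j b ↔
    F.infMul j (F.tp j a) = F.infMul j (F.tp j b) := Quotient.eq

variable [IsTopologicalGroup (F.Points M)]

theorem exists_of_toAmbit_eq {a b : F.Points N} (h : toAmbit j a = toAmbit j b) :
    ∃ c ∈ F.infinitesimals j, ∃ a', F.SameType j a a' ∧ c * a' = b := by
  rw [toAmbit_eq_iff] at h
  have hb : b ∈ F.infMul j (F.tp j b) :=
    ⟨1, mem_infinitesimals_iff.2 fun _ hU => hU.one_mem, b, rfl, one_mul b⟩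
  rw [← h] at hb
  obtain ⟨c, hc, a', ha', h⟩ := hb
  exact ⟨c, hc, a', (tp_eq_iff.1 ha').symm, h⟩

theorem SameType.exists_left_mul (hN : IsMonster L M N κ) {a b : F.Points N}
    (h : F.SameType j a b) {c : F.Points N} (hc : c ∈ F.infinitesimals j) :
    ∃ d ∈ F.infinitesimals j, F.SameType j (c * a) (d * b) := by
  obtain ⟨d, hd⟩ := h.exists_extend hN c
  refine ⟨d, ?_, sameType_of_imp fun X hX hca => ?_⟩
  · rw [mem_infinitesimals_iff] at hc ⊢
    exact fun U hU => hd (fun _ y => y ∈ U) (DefRel.mem hU.1 (.proj true)) (hc U hU)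
  · exact hd (fun x y => y * x ∈ X) (DefRel.mem hX ((DefFun.proj true).mul (.proj false))) hca

/-- The subgroup property of μ is essential: if d in μ makes db realize the other type, then eb =
(ed⁻¹)(db). -/
theorem toAmbit_mul (hN : IsMonster L M N κ) (hb : F.HasDefinableNhdsBasis M)
    {a c : F.Points N} (hc : c ∈ F.infinitesimals j) : toAmbit j (c * a) = toAmbit j a := by
  let I := infinitesimalSubgroup j hb
  rw [toAmbit_eq_iff]
  ext x
  constructor
  · rintro ⟨e, he, b, hb', rfl⟩
    have h1 : F.SameType j (c * a) b := (tp_eq_iff.1 hb').symm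
    obtain ⟨d, hd, hdb⟩ := h1.exists_left_mul hN (I.inv_mem hc)
    rw [inv_mul_cancel_left] at hdb
    exact ⟨e * d⁻¹, I.mul_mem he (I.inv_mem hd), d * b, tp_eq_iff.2 hdb.symm, by
      simp [mul_assoc]⟩
  · rintro ⟨e, he, b, hb', rfl⟩
    obtain ⟨d, hd, hdb⟩ := (tp_eq_iff.1 hb').symm.exists_left_mul hN hc
    exact ⟨e * d⁻¹, I.mul_mem he (I.inv_mem hd), d * b, tp_eq_iff.2 hdb.symm, by
      simp [mul_assoc]⟩

theorem isClosed_tp_image {X : Set (F.Points N)} (hX : F.IsDef j X) :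
    IsClosed (F.tp j '' X) := by
  obtain ⟨θ, hθ⟩ := hX.compl
  rw [← isOpen_compl_iff]
  refine TopologicalSpace.isOpen_generateFrom_of_mem ⟨θ, ?_⟩
  rw [← hθ]
  ext p
  obtain ⟨a, rfl⟩ : ∃ a, F.tp j a = p := Quotient.mk_surjective p
  constructor
  · exact fun h => ⟨a, fun ha => h ⟨a, ha, rfl⟩, rfl⟩
  · rintro ⟨b, hb, hba⟩ ⟨c, hc, hca⟩
    exact hb ((tp_eq_iff.1 (hca.trans hba.symm) X hX).1 hc)

/-- By saturation, the saturated preimage in the type space, the types of elements of μ·X, is the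
intersection of the closed sets given by U·X over definable neighbourhoods U. -/
theorem isClosed_toAmbit_image (hN : IsMonster L M N κ) (hb : F.HasDefinableNhdsBasis M)
    {X : Set (F.Points N)} (hX : F.IsDef j X) : IsClosed (toAmbit j '' X) := by
  classical
  have hq : Topology.IsQuotientMap (Quotient.mk (F.infSetoid j) : F.TypeSpace j → F.Ambit j) :=
    isQuotientMap_quot_mk
  refine hq.isClosed_preimage.1 ?_
  have h : (Quotient.mk (F.infSetoid j) : F.TypeSpace j → F.Ambit j) ⁻¹' (toAmbit j '' X) =
      ⋂ U : {U // F.IsDefNhd j U}, F.tp j '' (U.1 * X) := by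
    ext p
    obtain ⟨a, rfl⟩ : ∃ a, F.tp j a = p := Quotient.mk_surjective p
    constructor
    · rintro ⟨x, hx, hxa⟩
      obtain ⟨c, hc, x', hx', rfl⟩ := exists_of_toAmbit_eq hxa
      exact Set.mem_iInter.2 fun U => ⟨_, ⟨c, mem_infinitesimals_iff.1 hc _ U.2, x',
        (hx' X hX).1 hx, rfl⟩, rfl⟩
    · intro h
      have h1 : ∀ U : {U // F.IsDefNhd j U}, a ∈ U.1 * X := fun U => by
        obtain ⟨b, hb, hba⟩ := Set.mem_iInter.1 h U
        exact (tp_eq_iff.1 hba _ (U.2.1.mul hX)).1 hb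
      obtain ⟨c, hc, x, hx, rfl⟩ := mem_iInter_mul_iInter hN
        (fun U : {U // F.IsDefNhd j U} => U.2.1) (fun _ => hX) (fun s =>
          ⟨⟨⋂ U ∈ s, U.1, isDefNhd_biInter_finset s fun U _ => U.2⟩, fun U hU =>
            ⟨Set.biInter_subset_of_mem hU, subset_rfl⟩⟩) h1
      refine ⟨x, Set.mem_iInter.1 hx ⟨_, isDefNhd_univ⟩, (toAmbit_mul hN hb ?_).symm⟩
      exact mem_infinitesimals_iff.2 fun U hU => Set.mem_iInter.1 hc ⟨U, hU⟩
  refine (congrArg IsClosed h).mpr ?_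
  exact isClosed_iInter fun U => isClosed_tp_image (U.2.1.mul hX)

theorem ambitSMul_toAmbit (g : F.Points M) (a : F.Points N) :
    F.ambitSMul j g (toAmbit j a) = toAmbit j (F.incl j g * a) := rfl

variable (F j) in
/-- The action of `G(M)` on `S_G^μ(M)`. -/
abbrev ambitMulAction : MulAction (F.Points M) (F.Ambit j) where
  smul := F.ambitSMul j
  one_smul p := by
    obtain ⟨a, rfl⟩ := toAmbit_surjective p
    change F.ambitSMul j 1 _ = _
    rw [ambitSMul_toAmbit, map_one, one_mul]
  mul_smul g h p := by
    obtain ⟨a, rfl⟩ := toAmbit_surjective p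
    change F.ambitSMul j (g * h) _ = F.ambitSMul j g (F.ambitSMul j h _)
    simp only [ambitSMul_toAmbit, map_mul, mul_assoc]

theorem measureModel_ambit (hN : IsMonster L M N κ) (hb : F.HasDefinableNhdsBasis M)
    (ν : Measure (F.Ambit j)) [IsProbabilityMeasure ν]
    (hν : ∀ g : F.Points M, ∀ B : Set (F.Ambit j), MeasurableSet B →
      ν (F.ambitSMul j g ⁻¹' B) = ν B) :
    letI := F.ambitMulAction j
    MeasureModel j ν fun X => toAmbit j '' X := by
  let := F.ambitMulAction j
  refine ⟨inferInstance, fun g B hB => ?_, fun X hX => ?_, fun X Y _ _ => Set.image_union _ _ _,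
    ?_, fun g X _ => ?_, ?_⟩
  · rw [← Set.preimage_smul_inv]
    exact congrArg ENNReal.toReal (hν g⁻¹ B hB)
  · have : BorelSpace (F.Ambit j) := ⟨rfl⟩
    exact (isClosed_toAmbit_image hN hb hX).measurableSet
  · rw [Set.image_univ, toAmbit_surjective.range_eq]
  · rw [← Set.image_smul, ← Set.image_smul, Set.image_image, Set.image_image]
    rfl
  · rintro X Y U hX hY hU ⟨_, ⟨x, hx, rfl⟩, y, hy, hyx⟩
    obtain ⟨c, hc, x', hx', rfl⟩ := exists_of_toAmbit_eq hyx.symm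
    exact ⟨_, ⟨c, mem_infinitesimals_iff.1 hc U hU, x', (hx' X hX).1 hx, rfl⟩, hy⟩

end Ambit

end GroupFormulas

/-! ### The Samuel compactification of a topological group -/

section Samuel

variable {G : Type w} [Group G] [TopologicalSpace G]

/-- Two ultrafilters on `G` are near if their members are not separated by neighbourhoods of the
identity. -/
def Ultrafilter.Near (p q : Ultrafilter G) : Prop :=
  ∀ A ∈ p, ∀ B ∈ q, ∀ V ∈ 𝓝 (1 : G), ((V * A) ∩ B).Nonempty

theorem Ultrafilter.Near.mul_mem {p q : Ultrafilter G} (h : p.Near q) {A V : Set G} (hA : A ∈ p)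
    (hV : V ∈ 𝓝 (1 : G)) : V * A ∈ q := by
  by_contra hq
  obtain ⟨x, hx, hx'⟩ := h A hA _ (Ultrafilter.compl_mem_iff_notMem.2 hq) V hV
  exact hx' hx

theorem subset_nhds_mul {A V : Set G} (hV : V ∈ 𝓝 (1 : G)) : A ⊆ V * A := fun a ha =>
  ⟨1, mem_of_mem_nhds hV, a, ha, one_mul a⟩

namespace Samuel

/-- The ultrafilters that contain all neighbourhoods `V * A` of `A`. -/
def hull (A : Set G) : Set (Ultrafilter G) := {r | ∀ V ∈ 𝓝 (1 : G), V * A ∈ r}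

theorem mem_hull {A : Set G} {r : Ultrafilter G} (h : A ∈ r) : r ∈ hull A := fun _ hV =>
  Filter.mem_of_superset h (subset_nhds_mul hV)

theorem isClosed_hull (A : Set G) : IsClosed (hull A) := by
  have : hull A = ⋂ V ∈ 𝓝 (1 : G), {r : Ultrafilter G | V * A ∈ r} := by
    ext r; simp [hull]
  rw [this]
  exact isClosed_biInter fun V _ => ultrafilter_isClosed_basic _

end Samuel

variable [IsTopologicalGroup G]

variable (G) in
/-- Nearness of ultrafilters. -/
def samuelSetoid : Setoid (Ultrafilter G) where
  r := Ultrafilter.Near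
  iseqv := by
    refine ⟨fun p A hA B hB V hV => ?_, fun {p q} h A hA B hB V hV => ?_,
      fun {p q r} h h' A hA B hB V hV => ?_⟩
    · exact (p.neBot.nonempty_of_mem (Filter.inter_mem hA hB)).mono
        (Set.inter_subset_inter_left _ (subset_nhds_mul hV))
    · obtain ⟨_, ⟨v, hv, b, hb, rfl⟩, hx⟩ := h B hB A hA V⁻¹ (inv_mem_nhds_one G hV)
      exact ⟨b, ⟨v⁻¹, hv, v * b, hx, by simp⟩, hb⟩
    · obtain ⟨W, hWo, hW1, hWV⟩ := exists_open_nhds_one_mul_subset hV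
      have hW := hWo.mem_nhds hW1
      refine (h' _ (h.mul_mem hA hW) B hB W hW).mono (Set.inter_subset_inter_left _ ?_)
      rw [← mul_assoc]
      exact Set.mul_subset_mul_right hWV

variable (G) in
/-- The Samuel compactification of `G`. -/
abbrev Samuel : Type w := Quotient (samuelSetoid G)

namespace Samuel

theorem _root_.Ultrafilter.Near.mem_hull {p q : Ultrafilter G} (h : p.Near q) {A : Set G}
    (hp : p ∈ hull A) : q ∈ hull A := fun V hV => by
  obtain ⟨W, hWo, hW1, hWV⟩ := exists_open_nhds_one_mul_subset hV
  have hW := hWo.mem_nhds hW1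
  refine Filter.mem_of_superset (h.mul_mem (hp W hW) hW) ?_
  rw [← mul_assoc]
  exact Set.mul_subset_mul_right hWV

/-- The point of the Samuel compactification given by an ultrafilter. -/
def mk (p : Ultrafilter G) : Samuel G := Quotient.mk _ p

theorem mk_surjective : Function.Surjective (mk : Ultrafilter G → Samuel G) :=
  Quotient.mk_surjective

theorem mk_eq_iff {p q : Ultrafilter G} : mk p = mk q ↔ p.Near q := Quotient.eq

/-- The closure of a subset of `G` in the Samuel compactification. -/
def cl (A : Set G) : Set (Samuel G) := mk '' hull A

theorem mk_mem_cl {A : Set G} {p : Ultrafilter G} : mk p ∈ cl A ↔ p ∈ hull A := by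
  refine ⟨?_, fun h => ⟨p, h, rfl⟩⟩
  rintro ⟨q, hq, h⟩
  exact (mk_eq_iff.1 h).mem_hull hq

theorem isQuotientMap_mk : IsQuotientMap (mk : Ultrafilter G → Samuel G) := isQuotientMap_quot_mk

theorem isClosed_cl (A : Set G) : IsClosed (cl A) := by
  rw [← isQuotientMap_mk.isClosed_preimage]
  have : mk ⁻¹' cl A = hull A := Set.ext fun _ => mk_mem_cl
  rw [this]
  exact isClosed_hull A

/-- Neighbourhoods witnessing that an ultrafilter lies in neither hull can be intersected, and an
ultrafilter containing a union contains one of its parts. -/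
theorem cl_union (A B : Set G) : cl (A ∪ B) = cl A ∪ cl B := by
  ext x
  obtain ⟨p, rfl⟩ := mk_surjective x
  rw [Set.mem_union, mk_mem_cl, mk_mem_cl, mk_mem_cl]
  constructor
  · intro h
    by_contra! hcon
    obtain ⟨h1, h2⟩ := hcon
    simp only [hull, Set.mem_ofPred_eq, not_forall] at h1 h2
    obtain ⟨V, hV, h1⟩ := h1
    obtain ⟨W, hW, h2⟩ := h2
    have h3 := h _ (Filter.inter_mem hV hW)
    rw [Set.mul_union, Ultrafilter.union_mem_iff] at h3
    rcases h3 with h3 | h3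
    · exact h1 (Filter.mem_of_superset h3 (Set.mul_subset_mul_right Set.inter_subset_left))
    · exact h2 (Filter.mem_of_superset h3 (Set.mul_subset_mul_right Set.inter_subset_right))
  · rintro (h | h) V hV
    · exact Filter.mem_of_superset (h V hV) (Set.mul_subset_mul_left Set.subset_union_left)
    · exact Filter.mem_of_superset (h V hV) (Set.mul_subset_mul_left Set.subset_union_right)

theorem cl_univ : cl (Set.univ : Set G) = Set.univ := Set.eq_univ_of_forall fun x => by
  obtain ⟨p, rfl⟩ := mk_surjective x
  exact mk_mem_cl.2 (mem_hull Filter.univ_mem)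

theorem nonempty_of_mem_cl {A B : Set G} {x : Samuel G} (hA : x ∈ cl A) (hB : x ∈ cl B)
    {U : Set G} (hU : U ∈ 𝓝 (1 : G)) : ((U * A) ∩ B).Nonempty := by
  obtain ⟨p, rfl⟩ := mk_surjective x
  rw [mk_mem_cl] at hA hB
  obtain ⟨V, hV, -, hVinv, hVU⟩ := exists_closed_nhds_one_inv_eq_mul_subset hU
  obtain ⟨_, ⟨v, hv, a, ha, rfl⟩, v', hv', b, hb, h⟩ :=
    p.neBot.nonempty_of_mem (Filter.inter_mem (hA V hV) (hB V hV))
  have h' : v' * b = v * a := h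
  refine ⟨b, ⟨v'⁻¹ * v, hVU ⟨v'⁻¹, ?_, v, hv, rfl⟩, a, ha, ?_⟩, hb⟩
  · rw [← hVinv]
    exact Set.inv_mem_inv.2 hv'
  · change v'⁻¹ * v * a = b
    rw [mul_assoc, ← h', inv_mul_cancel_left]

/-- The complements of the sets `cl (V * A)ᶜ` thus serve as open neighbourhoods of `mk p`. -/
theorem notMem_cl_compl {A V : Set G} {p : Ultrafilter G} (hA : A ∈ p) (hV : V ∈ 𝓝 (1 : G)) :
    mk p ∉ cl (V * A)ᶜ := by
  intro h
  obtain ⟨x, ⟨v, hv, b, hb, rfl⟩, hx⟩ :=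
    nonempty_of_mem_cl h (mk_mem_cl.2 (mem_hull hA)) (inv_mem_nhds_one G hV)
  exact hb ⟨v⁻¹, hv, v * b, hx, by simp⟩

theorem mem_of_notMem_cl_compl {A : Set G} {p : Ultrafilter G} (h : mk p ∉ cl Aᶜ) : A ∈ p := by
  by_contra hA
  exact h (mk_mem_cl.2 (mem_hull (Ultrafilter.compl_mem_iff_notMem.2 hA)))

instance : T2Space (Samuel G) := by
  refine ⟨fun x y hxy => ?_⟩
  obtain ⟨p, rfl⟩ := mk_surjective x
  obtain ⟨q, rfl⟩ := mk_surjective y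
  have h : ¬ p.Near q := fun h => hxy (mk_eq_iff.2 h)
  simp only [Ultrafilter.Near, not_forall] at h
  obtain ⟨A, hA, B, hB, U, hU, h⟩ := h
  obtain ⟨V, hV, -, hVinv, hVU⟩ := exists_closed_nhds_one_inv_eq_mul_subset hU
  refine ⟨(cl (V * A)ᶜ)ᶜ, (cl (V * B)ᶜ)ᶜ, (isClosed_cl _).isOpen_compl,
    (isClosed_cl _).isOpen_compl, notMem_cl_compl hA hV, notMem_cl_compl hB hV, ?_⟩
  rw [Set.disjoint_left]
  intro z hzA hzB
  obtain ⟨r, rfl⟩ := mk_surjective z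
  obtain ⟨_, ⟨v, hv, a, ha, rfl⟩, v', hv', b, hb, h'⟩ := r.neBot.nonempty_of_mem
    (Filter.inter_mem (mem_of_notMem_cl_compl hzA) (mem_of_notMem_cl_compl hzB))
  have h'' : v' * b = v * a := h'
  refine h ⟨b, ⟨v'⁻¹ * v, hVU ⟨v'⁻¹, ?_, v, hv, rfl⟩, a, ha, ?_⟩, hb⟩
  · rw [← hVinv]
    exact Set.inv_mem_inv.2 hv'
  · change v'⁻¹ * v * a = b
    rw [mul_assoc, ← h'', inv_mul_cancel_left]

instance : Nonempty (Samuel G) := ⟨mk (pure 1)⟩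

theorem near_map {p q : Ultrafilter G} (h : p.Near q) (g : G) :
    (p.map (g * ·)).Near (q.map (g * ·)) := by
  intro A hA B hB V hV
  have hV' : (fun x => g * x * g⁻¹) ⁻¹' V ∈ 𝓝 (1 : G) :=
    (by fun_prop : Continuous fun x : G => g * x * g⁻¹).continuousAt.preimage_mem_nhds
      (by simpa using hV)
  obtain ⟨_, ⟨v, hv, a, ha, rfl⟩, hb⟩ := h _ hA _ hB _ hV'
  exact ⟨g * (v * a), ⟨g * v * g⁻¹, hv, g * a, ha, by simp [mul_assoc]⟩, hb⟩

instance : MulAction G (Samuel G) where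
  smul g := Quotient.map' (s₁ := samuelSetoid G) (s₂ := samuelSetoid G)
    (fun p => p.map (g * ·)) fun _ _ h => near_map h g
  one_smul x := by
    obtain ⟨p, rfl⟩ := mk_surjective x
    change mk (p.map (1 * ·)) = mk p
    simp only [one_mul]
    exact congrArg mk p.map_id
  mul_smul g h x := by
    obtain ⟨p, rfl⟩ := mk_surjective x
    change mk (p.map (g * h * ·)) = mk ((p.map (h * ·)).map (g * ·))
    rw [Ultrafilter.map_map]
    simp only [Function.comp_def, mul_assoc]

theorem smul_mk (g : G) (p : Ultrafilter G) : g • mk p = mk (p.map (g * ·)) := rfl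

theorem smul_mem_cl {g : G} {A : Set G} {x : Samuel G} (h : x ∈ cl A) : g • x ∈ cl (g • A) := by
  obtain ⟨p, rfl⟩ := mk_surjective x
  rw [smul_mk, mk_mem_cl]
  rw [mk_mem_cl] at h
  intro V hV
  have hV' : (fun x => g * x * g⁻¹) ⁻¹' V ∈ 𝓝 (1 : G) :=
    (by fun_prop : Continuous fun x : G => g * x * g⁻¹).continuousAt.preimage_mem_nhds
      (by simpa using hV)
  refine Ultrafilter.mem_map.2 (Filter.mem_of_superset (h _ hV') ?_)
  rintro _ ⟨v, hv, a, ha, rfl⟩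
  exact ⟨g * v * g⁻¹, hv, g * a, ⟨a, ha, rfl⟩, by simp [mul_assoc]⟩

theorem cl_smul (g : G) (A : Set G) : cl (g • A) = g • cl A := by
  ext x
  rw [Set.mem_smul_set_iff_inv_smul_mem]
  exact ⟨fun h => by simpa using smul_mem_cl (g := g⁻¹) h,
    fun h => by simpa using smul_mem_cl (g := g) h⟩

/-- An ultrafilter containing V·A for all A in q and all V is near q, so compactness of the space of
ultrafilters leaves one pair (A, V) that forces membership in O. -/
theorem exists_mul_subset_of_isOpen {O : Set (Samuel G)} (hO : IsOpen O) {q : Ultrafilter G}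
    (hq : mk q ∈ O) : ∃ A ∈ q, ∃ V ∈ 𝓝 (1 : G), ∀ r : Ultrafilter G, V * A ∈ r → mk r ∈ O := by
  have hF : IsClosed (mk ⁻¹' O)ᶜ := (hO.preimage isQuotientMap_mk.continuous).isClosed_compl
  let t : {A // A ∈ q} × {V // V ∈ 𝓝 (1 : G)} → Set (Ultrafilter G) :=
    fun i => {r | i.2.1 * i.1.1 ∈ r}
  have : Nonempty ({A // A ∈ q} × {V // V ∈ 𝓝 (1 : G)}) :=
    ⟨⟨_, Filter.univ_mem⟩, ⟨_, Filter.univ_mem⟩⟩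
  obtain ⟨⟨⟨A, hA⟩, ⟨V, hV⟩⟩, h⟩ := hF.isCompact.elim_directed_family_closed t
    (fun i => ultrafilter_isClosed_basic _) (by
      rw [Set.eq_empty_iff_forall_notMem]
      rintro r ⟨hr, hr'⟩
      refine hr (?_ : mk r ∈ O)
      have : q.Near r := fun A hA B hB V hV => r.neBot.nonempty_of_mem
        (Filter.inter_mem (Set.mem_iInter.1 hr' (⟨A, hA⟩, ⟨V, hV⟩)) hB)
      rwa [← mk_eq_iff.2 this]) (by
      intro i k
      refine ⟨(⟨_, Filter.inter_mem i.1.2 k.1.2⟩, ⟨_, Filter.inter_mem i.2.2 k.2.2⟩), ?_, ?_⟩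
      · exact fun r hr => Filter.mem_of_superset hr
          (Set.mul_subset_mul Set.inter_subset_left Set.inter_subset_left)
      · exact fun r hr => Filter.mem_of_superset hr
          (Set.mul_subset_mul Set.inter_subset_right Set.inter_subset_right))
  refine ⟨A, hA, V, hV, fun r hr => by_contra fun hrO => ?_⟩
  exact Set.eq_empty_iff_forall_notMem.1 h r ⟨hrO, hr⟩

/-- With WW ⊆ V, one factor W absorbs the change from g to h' = (h'g⁻¹)g, and the other the change
of the point. -/
instance : ContinuousSMul G (Samuel G) := by
  refine ⟨continuous_iff_continuousAt.2 fun ⟨g, x⟩ O hO => ?_⟩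
  obtain ⟨p, rfl⟩ := mk_surjective x
  obtain ⟨O', hO', hO'o, hgO'⟩ := mem_nhds_iff.1 hO
  obtain ⟨A, hA, V, hV, h⟩ := exists_mul_subset_of_isOpen hO'o (q := p.map (g * ·)) hgO'
  obtain ⟨W, hWo, hW1, hWV⟩ := exists_open_nhds_one_mul_subset hV
  have hW := hWo.mem_nhds hW1
  have h1 : (fun x => x * g⁻¹) ⁻¹' W ∈ 𝓝 g :=
    (by fun_prop : Continuous fun x : G => x * g⁻¹).continuousAt.preimage_mem_nhds
      (by simpa using hW)
  have h2 : (g⁻¹ • cl (W * A)ᶜ)ᶜ ∈ 𝓝 (mk p) := by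
    rw [← cl_smul]
    refine (isClosed_cl _).isOpen_compl.mem_nhds ?_
    rw [cl_smul, Set.mem_compl_iff, Set.mem_smul_set_iff_inv_smul_mem, inv_inv]
    exact notMem_cl_compl (p := p.map (g * ·)) hA hW
  rw [Filter.mem_map]
  filter_upwards [prod_mem_nhds h1 h2]
  rintro ⟨h', y⟩ ⟨hh, hy⟩
  obtain ⟨r, rfl⟩ := mk_surjective y
  refine hO' (h _ ?_)
  have h3 : mk (r.map (g * ·)) ∉ cl (W * A)ᶜ := fun h =>
    hy (by rw [Set.mem_smul_set_iff_inv_smul_mem, inv_inv]; exact h)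
  have h4 := mem_of_notMem_cl_compl h3
  refine Ultrafilter.mem_map.2 (Filter.mem_of_superset h4 ?_)
  rintro x ⟨w, hw, a, ha, hwa⟩
  have hwa' : w * a = g * x := hwa
  refine ⟨h' * g⁻¹ * w, hWV ⟨_, hh, w, hw, rfl⟩, a, ha, ?_⟩
  change h' * g⁻¹ * w * a = h' * x
  rw [mul_assoc, hwa', mul_assoc, inv_mul_cancel_left]

end Samuel

end Samuel

/-! ### The measure model on the Samuel compactification, and the conclusion. -/

namespace GroupFormulas

open MeasureTheory

theorem AllOpensDefinable.hasDefinableNhdsBasis {L : FirstOrder.Language.{u, v}}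
    {F : GroupFormulas L} {M : Type w} [L.Structure M] [F.GroupIn M]
    [TopologicalSpace (F.Points M)] (h : F.AllOpensDefinable M) : F.HasDefinableNhdsBasis M := by
  intro U hU
  obtain ⟨V, hVU, hVo, hV1⟩ := mem_nhds_iff.1 hU
  obtain ⟨θ, hθ⟩ := h V hVo
  have h1 : F.defSetBase (θ.relabel (Sum.inr : Fin F.dim → M ⊕ Fin F.dim)) = V := by
    rw [hθ]
    ext a
    exact Formula.realize_relabel
  exact ⟨_, by rw [h1]; exact hVo.mem_nhds hV1, by rwa [h1]⟩

theorem measureModel_samuel {L : FirstOrder.Language.{u, v}} {F : GroupFormulas L} {M : Type w}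
    [L.Structure M] {N : Type w'} [L.Structure N] {j : M ↪ₑ[L] N} [F.GroupIn M] [F.GroupIn N]
    [TopologicalSpace (F.Points M)] [IsTopologicalGroup (F.Points M)]
    [MeasurableSpace (Samuel (F.Points M))] [BorelSpace (Samuel (F.Points M))]
    (ν : Measure (Samuel (F.Points M))) [IsProbabilityMeasure ν]
    (hν : ∀ g : F.Points M, ∀ B : Set (Samuel (F.Points M)), MeasurableSet B →
      ν ((fun x => g • x) ⁻¹' B) = ν B) :
    MeasureModel j ν fun X => Samuel.cl (F.incl j ⁻¹' X) := by
  refine ⟨inferInstance, fun g B hB => ?_, fun X _ => (Samuel.isClosed_cl _).measurableSet,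
    fun X Y _ _ => Samuel.cl_union _ _, Samuel.cl_univ, fun g X _ => ?_, ?_⟩
  · rw [← Set.preimage_smul_inv]
    exact congrArg ENNReal.toReal (hν g⁻¹ B hB)
  · rw [← Samuel.cl_smul]
    congr 1
    ext a
    simp [Set.mem_smul_set_iff_inv_smul_mem]
  · rintro X Y U _ _ hU ⟨x, hX, hY⟩
    obtain ⟨_, ⟨u, hu, a, ha, rfl⟩, hb⟩ := Samuel.nonempty_of_mem_cl hX hY hU.2
    exact ⟨_, ⟨_, hu, _, ha, (map_mul _ _ _).symm⟩, hb⟩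

end GroupFormulas

theorem mainTheorem2 {L : FirstOrder.Language.{u, v}} (F : GroupFormulas L)
    {M : Type w} [L.Structure M] {N : Type w'} [L.Structure N] (j : M ↪ₑ[L] N)
    (κ : Cardinal.{w'}) (hN : IsMonster L M N κ)
    [F.GroupIn M] [F.GroupIn N]
    [TopologicalSpace (F.Points M)] [IsTopologicalGroup (F.Points M)] :
    (F.HasDefinableNhdsBasis M → F.DefinablyTopologicallyAmenable j →
      F.component00DefTop j κ = F.component000DefTop j κ) ∧
    (F.AllOpensDefinable M → IsAmenableTopGroup (F.Points M) →
      F.component00DefTop j κ = F.component000DefTop j κ) := by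
  constructor
  · rintro hb ⟨ν, _, hν⟩
    let := F.ambitMulAction j
    exact GroupFormulas.component00DefTop_eq hN hb (GroupFormulas.measureModel_ambit hN hb ν hν)
  · intro hopen ham
    let : MeasurableSpace (Samuel (F.Points M)) := borel _
    have : BorelSpace (Samuel (F.Points M)) := ⟨rfl⟩
    -- The Samuel compactification is used in place of S^μ_G(M): it is a flow in the universe of
    -- G(M), built without reference to N.
    obtain ⟨ν, _, hν⟩ := ham (Samuel (F.Points M))
    exact GroupFormulas.component00DefTop_eq hN hopen.hasDefinableNhdsBasis
      (GroupFormulas.measureModel_samuel ν hν)
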